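/- Let $n\ge 1$ be an integer and let $F$ be a finite field of characteristic different from $2$, with a non-principal additive character $e:F\to\mathbb{C}^\times$. For $f:F^n\to\mathbb{C}$ put $\hat f(\xi)=\sum_{x\in F^n}f(x)e(-x\cdot\xi)$ and $\|f\|_{L^r(F^n)}=\big(\sum_{x\in F^n}|f(x)|^r\big)^{1/r}$. Let $\mathcal{P}=\{(\gamma,\gamma\cdot\gamma):\gamma\in F^{n-1}\}\subset F^n$ be the paraboloid, and for $g:\mathcal{P}\to\mathbb{C}$ put $\|g\|_{L^r(\mathcal{P},d\sigma)}=\big(|\mathcal{P}|^{-1}\sum_{\xi\in\mathcal{P}}|g(\xi)|^r\big)^{1/r}$. For $1<p,q<\infty$ with conjugate exponents $p',q'$, let $\mathcal{R}(p\to q)$ be the smallest constant such that \[\|\hat f\|_{L^{p'}(\mathcal{P},d\sigma)}\le \mathcal{R}(p\to q)\,\|f\|_{L^{q'}(F^n)}\qquad\text{for all } f:F^n\to\mathbb{C}.\] Theorem. For every $n$ there is a constant $C_n$, depending only on $n$ (and not on $F$ or $e$), with the following property. If either $n\ge 4$ is even, or $n$ is odd and $|F|=q_0^m$ for a prime $q_0\equiv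 3 \pmod 4$ such that $m(n-1)$ is not a multiple of $4$, then \[\mathcal{R}\Big(\tfrac{4n}{3n-2}\to 4\Big)\le C_n\qquad\text{and}\qquad \mathcal{R}\Big(2\to\tfrac{2n^2}{n^2-2n+2}\Big)\le C_n .\] -/

import Mathlib

open scoped NNReal ENNReal

noncomputable section

namespace FiniteFieldRestriction

variable {F : Type*} [Field F] [Fintype F] {n : ℕ}

/-- The point `(γ, γ · γ)` of `F ^ n` (for `n ≥ 1`), where `γ ∈ F ^ (n - 1)`. -/
def paraboloidPoint (γ : Fin (n - 1) → F) : Fin n → F :=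
  fun i => if h : (i : ℕ) < n - 1 then γ ⟨i, h⟩ else γ ⬝ᵥ γ

variable (F n) in
open Classical in
/-- The paraboloid `{(γ, γ · γ) : γ ∈ F ^ (n - 1)}` in `F ^ n` (for `n ≥ 1`). -/
def paraboloid : Finset (Fin n → F) :=
  Finset.univ.image paraboloidPoint

/-- The Fourier transform `ξ ↦ ∑ x, f x * e (- x · ξ)`; `F ^ n` carries the counting measure. -/
def fourier (e : AddChar F ℂ) (f : (Fin n → F) → ℂ) (ξ : Fin n → F) : ℂ :=
  ∑ x, f x * e (-(x ⬝ᵥ ξ))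

/-- The `L ^ q` norm on `F ^ n` with respect to the counting measure. -/
def normSpace (q : ℝ) (f : (Fin n → F) → ℂ) : ℝ :=
  (∑ x, ‖f x‖ ^ q) ^ (1 / q)

/-- The `L ^ q` norm on the paraboloid with respect to the normalized surface measure, which gives
every point of the paraboloid the mass `1 / |P|`. Only the values of `g` on the paraboloid
matter. -/
def normSurface (q : ℝ) (g : (Fin n → F) → ℂ) : ℝ :=
  (1 / ((paraboloid F n).card : ℝ) * ∑ ξ ∈ paraboloid F n, ‖g ξ‖ ^ q) ^ (1 / q)

variable (n) in
/-- `R(p → q)`: the best constant `C` in the restriction inequality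
`‖f̂‖_{L ^ p'(P, dσ)} ≤ C * ‖f‖_{L ^ q'(F ^ n)}` for all `f : F ^ n → ℂ`, where `p'` and `q'` are
the exponents conjugate to `p` and `q` (it is `∞` if no finite constant works). -/
def restrictionConst (e : AddChar F ℂ) (p q : ℝ) : ℝ≥0∞ :=
  ⨅ (C : ℝ≥0) (_ : ∀ f : (Fin n → F) → ℂ,
    normSurface p.conjExponent (fourier e f) ≤ C * normSpace q.conjExponent f), (C : ℝ≥0∞)

end FiniteFieldRestriction

end

open scoped NNReal ENNReal

/-! Write q = |F| and d = n - 1. Both estimates rest on counting the solutions of a + b = c + z, a·a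
+ b·b = c·c + z·z in a set E ⊂ F^d (`liftEnergy`). Such a quadruple is a parallelogram with a right
angle at c: (c - a)·(b - c) = 0. If c - a is not isotropic, the inversion x = (c - a)/((c - a)·(c -
a)) turns this into x·(b - a) = 1, a point–hyperplane incidence, and a second moment gives at most
|E|²/q + q^((d-1)/2)|E| pairs (c, b) for each a. If c - a is isotropic, b is left free and pairs
with isotropic difference are counted by Gauss sums (`isotropicPairs_le`). The arithmetic hypotheses
enter only through isotropic vectors: either d is odd, or d = 2k with k odd and -1 is not a square,
and then the large value of the exponential sum has a favourable sign. This gives `liftEnergy_le`.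
For d = 2 there are no isotropic vectors, and Cauchy–Schwarz yields the bound |E|^(5/2) of
`liftEnergy_le_of_anisotropic`.

By orthogonality the energy controls the L⁴ norm of the extension operator on functions bounded by
the indicator of E; interpolation and duality give the first estimate. For the second, ‖f̂‖² on the
paraboloid is the pairing of f with f * σ^∨. Cut f into slices of constant last coordinate. Away
from its own height, the convolution of a slice is, by completing the square, the extension of that
slice evaluated at moved points (`norm_sliceConv`), so its L⁴ norm is again an energy. Hölder and a
power mean over the q slices give bounds that are interpolated with Stein–Tomas and with the
Plancherel bound.

Passing from functions bounded by indicators to all f loses no logarithm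
(`exists_strong_type_of_restricted_type`): two bounds Q^a N^α and Q^b N^β with β < ρ < α decay
geometrically away from a critical dyadic level, so the sum over levels converges, uniformly in Q.
-/

/-! ### Interpolation of restricted bounds without logarithmic loss -/

theorem exists_sum_rpow_abs_sub_le {δ : ℝ} (hδ : 0 < δ) :
    ∃ C : ℝ, 0 ≤ C ∧ ∀ (K : Finset ℤ) (κ : ℝ), ∑ k ∈ K, (2 : ℝ) ^ (-δ * |(k : ℝ) - κ|) ≤ C := by
  have hs : Summable fun k : ℤ => (2 : ℝ) ^ (-δ * |(k : ℝ)|) := by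
    have h2 : Summable fun k : ℕ => ((2 : ℝ) ^ (-δ)) ^ k :=
      summable_geometric_of_lt_one (by positivity)
        (Real.rpow_lt_one_of_one_lt_of_neg (by norm_num) (by linarith))
    refine Summable.of_nat_of_neg ?_ ?_ <;>
    · refine h2.congr fun k => ?_
      rw [← Real.rpow_natCast, ← Real.rpow_mul (by norm_num)]
      simp
  -- Rounding κ to its floor moves each exponent by at most δ, whence the factor 2^δ.
  refine ⟨2 ^ δ * ∑' k : ℤ, (2 : ℝ) ^ (-δ * |(k : ℝ)|), by positivity, fun K κ => ?_⟩
  have h1 : ∀ k ∈ K, (2 : ℝ) ^ (-δ * |(k : ℝ) - κ|) ≤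
      2 ^ δ * 2 ^ (-δ * |((k - ⌊κ⌋ : ℤ) : ℝ)|) := fun k _ => by
    rw [← Real.rpow_add (by norm_num)]
    refine Real.rpow_le_rpow_of_exponent_le (by norm_num) ?_
    have h3 : |((k - ⌊κ⌋ : ℤ) : ℝ)| ≤ |(k : ℝ) - κ| + 1 := by
      have h4 : ((k - ⌊κ⌋ : ℤ) : ℝ) = ((k : ℝ) - κ) + (κ - ⌊κ⌋) := by push_cast; ring
      have h5 : |κ - ⌊κ⌋| ≤ 1 := by
        rw [abs_le]
        constructor <;> linarith [Int.floor_le κ, Int.lt_floor_add_one κ]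
      rw [h4]
      exact (abs_add_le _ _).trans (by linarith)
    nlinarith
  refine (Finset.sum_le_sum h1).trans ?_
  rw [← Finset.mul_sum]
  refine mul_le_mul_of_nonneg_left ?_ (by positivity)
  have h6 : ∑ k ∈ K, (2 : ℝ) ^ (-δ * |((k - ⌊κ⌋ : ℤ) : ℝ)|) =
      ∑ k ∈ K.image fun k => k - ⌊κ⌋, (2 : ℝ) ^ (-δ * |(k : ℝ)|) := by
    rw [Finset.sum_image]
    intro x _ y _ h
    simpa using h
  rw [h6]
  exact hs.sum_le_tsum _ fun _ _ => by positivity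

/-- One dyadic level: at height 2^k the size N is at most (S^ρ 2^(-k))^(1/ρ). The first bound wins
for large k and the second for small k, with decay on both sides of κ and no dependence on Q left.
-/
theorem two_zpow_mul_min_le {ρ α β a b δ : ℝ} (hρ : 0 < ρ) (hβ : 0 ≤ β)
    (hβρ : β < ρ) (hα : ρ < α) (hab : a * (ρ - β) + b * (α - ρ) ≤ 0)
    (hδ : δ = min ((α - ρ) / ρ) ((ρ - β) / ρ))
    {Q S : ℝ} (hQ : 1 ≤ Q) (hS : 0 < S) :
    ∃ κ : ℝ, ∀ (k : ℤ) (N : ℝ), 0 ≤ N → N * ((2 : ℝ) ^ k) ^ (1 / ρ) ≤ S →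
      (2 : ℝ) ^ k * min (Q ^ a * N ^ α) (Q ^ b * N ^ β) ≤
        S ^ ρ * (2 : ℝ) ^ (-δ * |(k : ℝ) - κ|) := by
  have hQ0 : 0 < Q := by linarith
  set L := Real.logb 2 Q with hL
  set s := Real.logb 2 S with hs
  have hL0 : 0 ≤ L := Real.logb_nonneg (by norm_num) hQ
  have hQe : Q = (2 : ℝ) ^ L := (Real.rpow_logb (by norm_num) (by norm_num) hQ0).symm
  have hSe : S = (2 : ℝ) ^ s := (Real.rpow_logb (by norm_num) (by norm_num) hS).symm
  have hαρ : 0 < α - ρ := by linarith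
  have hρβ : 0 < ρ - β := by linarith
  -- κ is the zero in k of a L + (α - ρ)(s - k/ρ), the logarithm of the first bound relative to S^ρ
  -- at the largest admissible N.
  refine ⟨(a * L / (α - ρ) + s) * ρ, fun k N hN hNS => ?_⟩
  set κ := (a * L / (α - ρ) + s) * ρ with hκ
  set u : ℝ := (2 : ℝ) ^ (s - k / ρ) with hu
  have hk : ((2 : ℝ) ^ k) = (2 : ℝ) ^ (k : ℝ) := (Real.rpow_intCast 2 k).symm
  have hNu : N ≤ u := by
    have h1 : ((2 : ℝ) ^ k) ^ (1 / ρ) = 2 ^ ((k : ℝ) / ρ) := by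
      rw [hk, ← Real.rpow_mul (by norm_num)]; congr 1; ring
    rw [h1, ← le_div_iff₀ (by positivity), hSe, ← Real.rpow_sub (by norm_num)] at hNS
    exact hNS
  have key : ∀ c γ : ℝ, 0 ≤ γ → (2 : ℝ) ^ k * (Q ^ c * N ^ γ) ≤
      S ^ ρ * (2 : ℝ) ^ (c * L + (γ - ρ) * (s - k / ρ)) := fun c γ hγ => by
    have h1 : N ^ γ ≤ u ^ γ := Real.rpow_le_rpow hN hNu hγ
    calc (2 : ℝ) ^ k * (Q ^ c * N ^ γ) ≤ (2 : ℝ) ^ k * (Q ^ c * u ^ γ) := by gcongr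
      _ = S ^ ρ * (2 : ℝ) ^ (c * L + (γ - ρ) * (s - k / ρ)) := by
        rw [hk, hu, hQe, hSe]
        simp only [← Real.rpow_mul (show (0 : ℝ) ≤ 2 by norm_num)]
        simp only [← Real.rpow_add (show (0 : ℝ) < 2 by norm_num)]
        congr 1
        field_simp
        ring
  have hSρ : 0 < S ^ ρ := by positivity
  have hδ1 : δ ≤ (α - ρ) / ρ := hδ ▸ min_le_left _ _
  have hδ2 : δ ≤ (ρ - β) / ρ := hδ ▸ min_le_right _ _
  rcases le_total κ k with h | h
  · refine (mul_le_mul_of_nonneg_left (min_le_left _ _) (by positivity)).trans ?_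
    refine (key a α (by linarith)).trans ?_
    refine mul_le_mul_of_nonneg_left
      (Real.rpow_le_rpow_of_exponent_le (by norm_num) ?_) hSρ.le
    rw [abs_of_nonneg (by linarith)]
    have h1 : a * L + (α - ρ) * (s - k / ρ) = -((α - ρ) / ρ) * (k - κ) := by
      rw [hκ]; field_simp; ring
    rw [h1]
    nlinarith
  · refine (mul_le_mul_of_nonneg_left (min_le_right _ _) (by positivity)).trans ?_
    refine (key b β hβ).trans ?_
    refine mul_le_mul_of_nonneg_left
      (Real.rpow_le_rpow_of_exponent_le (by norm_num) ?_) hSρ.le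
    rw [abs_of_nonpos (by linarith)]
    -- The balance condition `hab` says that the second exponent is also nonpositive at k = κ.
    have h1 : b * L ≤ -(ρ - β) * (a * L / (α - ρ)) := by
      have h3 : b ≤ -(ρ - β) * (a / (α - ρ)) := by
        rw [← sub_nonneg]
        have : -(ρ - β) * (a / (α - ρ)) - b = -(a * (ρ - β) + b * (α - ρ)) / (α - ρ) := by
          field_simp; ring
        rw [this]
        exact div_nonneg (by linarith) hαρ.le
      calc b * L ≤ (-(ρ - β) * (a / (α - ρ))) * L := by gcongr
        _ = _ := by ring
    have h2 : -(ρ - β) * (a * L / (α - ρ)) + (β - ρ) * (s - k / ρ) =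
        -((ρ - β) / ρ) * (κ - k) := by
      rw [hκ]; field_simp; ring
    have h4 : (δ - (ρ - β) / ρ) * (κ - k) ≤ 0 :=
      mul_nonpos_of_nonpos_of_nonneg (by linarith) (by linarith)
    nlinarith

open Finset in
/-- A subadditive functional obeying, on functions bounded by the indicator of a set of size `N`,
bounds by `N ^ α` and `N ^ β` with `β < ρ < α` that balance at `ρ`, is bounded on `L ^ (1 / ρ)`. -/
theorem exists_strong_type_of_restricted_type {ι : Type*} (J : Finset ι) {ρ : ℝ} (hρ : 0 < ρ)
    (α β a b : ι → ℝ) (hβ : ∀ i, 0 ≤ β i) (hβρ : ∀ i, β i < ρ) (hα : ∀ i, ρ < α i)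
    (hab : ∀ i, a i * (ρ - β i) + b i * (α i - ρ) ≤ 0) :
    ∃ C : ℝ, 0 ≤ C ∧ ∀ (Q K : ℝ), 1 ≤ Q → 0 ≤ K → ∀ (X : Type*) [Fintype X] (V : (X → ℂ) → ℝ),
      V 0 = 0 → (∀ f g, V (f + g) ≤ V f + V g) → (∀ (c : ℝ) f, 0 ≤ c → V (c • f) = c * V f) →
      (∀ (E : Finset X) (f : X → ℂ), (∀ x, ‖f x‖ ≤ 1) → (∀ x, x ∉ E → f x = 0) →
        V f ≤ K * ∑ i ∈ J, min (Q ^ a i * (#E : ℝ) ^ α i) (Q ^ b i * (#E : ℝ) ^ β i)) →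
      ∀ f, V f ≤ K * C * (∑ x, ‖f x‖ ^ (1 / ρ)) ^ ρ := by
  classical
  set δ : ι → ℝ := fun i => min ((α i - ρ) / ρ) ((ρ - β i) / ρ) with hδdef
  have hδ : ∀ i, 0 < δ i := fun i => lt_min
    (div_pos (by linarith [hα i]) hρ) (div_pos (by linarith [hβρ i]) hρ)
  choose c hc0 hc using fun i => exists_sum_rpow_abs_sub_le (hδ i)
  refine ⟨2 * ∑ i ∈ J, c i, mul_nonneg (by norm_num) (sum_nonneg fun i _ => hc0 i), ?_⟩
  intro Q K hQ hK X _ V hV0 hVadd hVsmul hV f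
  set S := ∑ x, ‖f x‖ ^ (1 / ρ) with hS
  rcases eq_or_ne f 0 with rfl | hf
  · rw [hV0]
    have h0 : 0 ≤ ∑ i ∈ J, c i := sum_nonneg fun i _ => hc0 i
    have h1 : 0 ≤ S := sum_nonneg fun _ _ => by positivity
    positivity
  have hSpos : 0 < S := by
    obtain ⟨x, hx⟩ := Function.ne_iff.mp hf
    have hx' : 0 < ‖f x‖ := norm_pos_iff.mpr hx
    exact sum_pos' (fun _ _ => by positivity) ⟨x, mem_univ x, by positivity⟩
  -- Dyadic levels of |f|. `Int.log` gives zeros of f the default level 0, so `E` has to exclude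
  -- them explicitly.
  set lev : X → ℤ := fun x => Int.log 2 ‖f x‖ with hlev
  set E : ℤ → Finset X := fun k => univ.filter fun x => f x ≠ 0 ∧ lev x = k with hE
  set T : Finset ℤ := univ.image lev with hT
  set g : ℤ → X → ℂ := fun k x => if x ∈ E k then f x else 0 with hg
  have hfg : f = ∑ k ∈ T, g k := by
    funext x
    rw [Finset.sum_apply]
    by_cases hx : f x = 0
    · simp [hg, hE, hx]
    · rw [sum_eq_single (lev x)]
      · simp [hg, hE, hx]
      · intro k _ hk
        simp [hg, hE, hk.symm]
      · intro h
        exact absurd (mem_image_of_mem lev (mem_univ x)) h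
  have hVsum : ∀ T : Finset ℤ, V (∑ k ∈ T, g k) ≤ ∑ k ∈ T, V (g k) := fun T => by
    induction T using Finset.induction_on with
    | empty => simp [hV0]
    | insert k T hk ih =>
      rw [sum_insert hk, sum_insert hk]
      linarith [hVadd (g k) (∑ k ∈ T, g k)]
  have hbd : ∀ k x, x ∈ E k → (2 : ℝ) ^ k ≤ ‖f x‖ ∧ ‖f x‖ < 2 ^ (k + 1) := fun k x hx => by
    obtain ⟨hx0, rfl⟩ := (mem_filter.mp hx).2
    have h1 := Int.zpow_log_le_self (b := 2) (by norm_num) (norm_pos_iff.mpr hx0)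
    have h2 := Int.lt_zpow_succ_log_self (b := 2) (by norm_num) ‖f x‖
    exact ⟨by exact_mod_cast h1, by exact_mod_cast h2⟩
  have hcard : ∀ k, (#(E k) : ℝ) * ((2 : ℝ) ^ k) ^ (1 / ρ) ≤ S := fun k => by
    rw [← nsmul_eq_mul, ← sum_const]
    refine (sum_le_sum (g := fun x => ‖f x‖ ^ (1 / ρ)) fun x hx => ?_).trans
      (sum_le_univ_sum_of_nonneg fun x => by positivity)
    exact Real.rpow_le_rpow (by positivity) (hbd k x hx).1 (by positivity)
  have hVk : ∀ k, V (g k) ≤ 2 * K * ∑ i ∈ J, (2 : ℝ) ^ k *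
      -- Dividing by 2^(k+1) makes `g k` bounded by 1; the factor 2 is the ratio of the ends of a
      -- dyadic interval.
      min (Q ^ a i * (#(E k) : ℝ) ^ α i) (Q ^ b i * (#(E k) : ℝ) ^ β i) := fun k => by
    have h2 : (0 : ℝ) < 2 ^ (k + 1) := by positivity
    have h1 : g k = (2 : ℝ) ^ (k + 1) • (((2 : ℝ) ^ (k + 1))⁻¹ • g k) := by
      rw [smul_smul, mul_inv_cancel₀ h2.ne', one_smul]
    rw [h1, hVsmul _ _ h2.le]
    have h3 := hV (E k) (((2 : ℝ) ^ (k + 1))⁻¹ • g k) (fun x => ?_) (fun x hx => ?_)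
    · calc _ ≤ (2 : ℝ) ^ (k + 1) * _ := mul_le_mul_of_nonneg_left h3 h2.le
        _ = _ := by rw [← mul_sum, zpow_add_one₀ (by norm_num)]; ring
    · by_cases hx : x ∈ E k
      · simp only [hg, Pi.smul_apply, hx, if_true, norm_smul, norm_inv, Real.norm_of_nonneg h2.le]
        rw [inv_mul_le_iff₀ h2, mul_one]
        exact (hbd k x hx).2.le
      · simp [hg, hx]
    · simp [hg, hx]
  choose κ hκ using fun i => two_zpow_mul_min_le hρ (hβ i) (hβρ i) (hα i) (hab i)
    (δ := δ i) rfl hQ hSpos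
  calc V f = V (∑ k ∈ T, g k) := by rw [← hfg]
    _ ≤ ∑ k ∈ T, V (g k) := hVsum T
    _ ≤ ∑ k ∈ T, 2 * K * ∑ i ∈ J, (2 : ℝ) ^ k *
      min (Q ^ a i * (#(E k) : ℝ) ^ α i) (Q ^ b i * (#(E k) : ℝ) ^ β i) :=
        sum_le_sum fun k _ => hVk k
    _ ≤ ∑ k ∈ T, 2 * K * ∑ i ∈ J, S ^ ρ * (2 : ℝ) ^ (-δ i * |(k : ℝ) - κ i|) := by
        refine sum_le_sum fun k _ => mul_le_mul_of_nonneg_left (sum_le_sum fun i _ => ?_)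
          (mul_nonneg zero_le_two hK)
        exact hκ i k _ (Nat.cast_nonneg _) (hcard k)
    _ = 2 * K * S ^ ρ * ∑ i ∈ J, ∑ k ∈ T, (2 : ℝ) ^ (-δ i * |(k : ℝ) - κ i|) := by
        rw [sum_comm, mul_sum]
        refine sum_congr rfl fun k _ => ?_
        rw [mul_assoc (2 * K), mul_sum J _ (S ^ ρ)]
    _ ≤ 2 * K * S ^ ρ * ∑ i ∈ J, c i := by
        exact mul_le_mul_of_nonneg_left (sum_le_sum fun i _ => hc i T (κ i)) (by positivity)
    _ = _ := by ring

open Finset ComplexConjugate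

/-! ### Orthogonality and quadratic Gauss sums -/

section CharacterSums

variable {F : Type*} [Field F] [Fintype F] {d : ℕ}

theorem ofReal_norm_sq_sum {ι : Type*} (s : Finset ι) (a : ι → ℂ) :
    ((‖∑ i ∈ s, a i‖ ^ 2 : ℝ) : ℂ) = ∑ i ∈ s, ∑ j ∈ s, a i * conj (a j) := by
  push_cast
  rw [← Complex.mul_conj', map_sum, sum_mul_sum]

theorem sum_addChar_mul_eq_zero {e : AddChar F ℂ} (he : e ≠ 1) {b : F} (hb : b ≠ 0) :
    ∑ t, e (t * b) = 0 := by
  classical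
  have := AddChar.sum_mulShift b (AddChar.IsPrimitive.of_ne_one he)
  simpa [hb] using this

theorem sum_addChar_dotProduct_eq_zero {e : AddChar F ℂ} (he : e ≠ 1) {y : Fin d → F}
    (hy : y ≠ 0) : ∑ x : Fin d → F, e (x ⬝ᵥ y) = 0 := by
  obtain ⟨i, hi⟩ := Function.ne_iff.mp hy
  obtain ⟨a, ha⟩ := AddChar.ne_one_iff.mp he
  let ψ : AddChar (Fin d → F) ℂ :=
    { toFun := fun x => e (x ⬝ᵥ y)
      map_zero_eq_one' := by simp
      map_add_eq_mul' := fun x x' => by rw [add_dotProduct, AddChar.map_add_eq_mul] }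
  have hψ : ψ ≠ 0 := by
    refine AddChar.ne_zero_iff.mpr ⟨Pi.single i (a / y i), ?_⟩
    change e (Pi.single i (a / y i) ⬝ᵥ y) ≠ 1
    rwa [single_dotProduct, div_mul_cancel₀ _ hi]
  exact AddChar.sum_eq_zero_iff_ne_zero.mpr hψ

theorem sum_norm_sq_fourier {e : AddChar F ℂ} (he : e ≠ 1) (f : (Fin d → F) → ℂ) :
    ∑ ξ, ‖∑ x, f x * e (x ⬝ᵥ ξ)‖ ^ 2 = (Fintype.card F : ℝ) ^ d * ∑ x, ‖f x‖ ^ 2 := by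
  classical
  have h : ((∑ ξ, ‖∑ x, f x * e (x ⬝ᵥ ξ)‖ ^ 2 : ℝ) : ℂ) =
      (((Fintype.card F : ℝ) ^ d * ∑ x, ‖f x‖ ^ 2 : ℝ) : ℂ) := by
    rw [Complex.ofReal_sum]
    simp only [ofReal_norm_sq_sum]
    rw [sum_comm]
    push_cast
    rw [mul_sum]
    refine sum_congr rfl fun x _ => ?_
    rw [sum_comm, sum_eq_single x]
    · simp only [map_mul, ← AddChar.map_neg_eq_conj]
      have : ∀ ξ : Fin d → F, f x * e (x ⬝ᵥ ξ) * (conj (f x) * e (-(x ⬝ᵥ ξ))) = ‖f x‖ ^ 2 :=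
        fun ξ => by
          rw [← Complex.mul_conj', mul_mul_mul_comm, ← AddChar.map_add_eq_mul]
          simp
      simp [this]
    · intro y _ hy
      have h1 : ∀ ξ : Fin d → F, f x * e (x ⬝ᵥ ξ) * conj (f y * e (y ⬝ᵥ ξ)) =
          f x * conj (f y) * e (ξ ⬝ᵥ (x - y)) := fun ξ => by
        rw [map_mul, ← AddChar.map_neg_eq_conj, mul_mul_mul_comm, ← AddChar.map_add_eq_mul,
          dotProduct_sub, dotProduct_comm x, dotProduct_comm y, sub_eq_add_neg]
      simp only [h1]
      rw [← mul_sum, sum_addChar_dotProduct_eq_zero he (sub_ne_zero.mpr hy.symm), mul_zero]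
    · simp
  exact_mod_cast h

variable (d) in
/-- The Gauss sum of the quadratic form `γ ↦ s * γ · γ` on `F ^ d`. -/
noncomputable def quadSum (e : AddChar F ℂ) (s : F) : ℂ :=
  ∑ γ : Fin d → F, e (s * (γ ⬝ᵥ γ))

theorem four_ne_zero_of_two {F : Type*} [Field F] (h2 : (2 : F) ≠ 0) : (4 : F) ≠ 0 := by
  have : (4 : F) = 2 * 2 := by norm_num
  rw [this]
  exact mul_ne_zero h2 h2

/-- Completing the square: translation by y/(2s). -/
theorem sum_addChar_quadratic (h2 : (2 : F) ≠ 0) (e : AddChar F ℂ) (y : Fin d → F) {s : F}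
    (hs : s ≠ 0) :
    ∑ γ, e (y ⬝ᵥ γ + s * (γ ⬝ᵥ γ)) = quadSum d e s * e (-(y ⬝ᵥ y) / (4 * s)) := by
  rw [quadSum, sum_mul]
  have h4 := four_ne_zero_of_two h2
  refine Fintype.sum_equiv (Equiv.addRight ((2 * s)⁻¹ • y)) _ _ fun γ => ?_
  rw [← AddChar.map_add_eq_mul]
  congr 1
  simp only [Equiv.coe_addRight, dotProduct_add, add_dotProduct, dotProduct_smul, smul_dotProduct,
    smul_eq_mul, dotProduct_comm γ y]
  field_simp
  ring

theorem conj_quadSum (e : AddChar F ℂ) (s : F) : conj (quadSum d e s) = quadSum d e (-s) := by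
  simp [quadSum, map_sum, ← AddChar.map_neg_eq_conj]

theorem quadSum_mul_sq (e : AddChar F ℂ) (s : F) {t : F} (ht : t ≠ 0) :
    quadSum d e (s * t ^ 2) = quadSum d e s := by
  refine Fintype.sum_equiv (Equiv.smulRight ht : (Fin d → F) ≃ (Fin d → F)) _ _ fun γ => ?_
  simp only [Equiv.smulRight_apply, dotProduct_smul, smul_dotProduct, smul_eq_mul]
  congr 1
  ring

/-- After the substitution x = y + u the squared modulus is linear in y, so only u = 0 survives. -/
theorem norm_quadSum_sq (h2 : (2 : F) ≠ 0) {e : AddChar F ℂ} (he : e ≠ 1) {s : F} (hs : s ≠ 0) :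
    ‖quadSum d e s‖ ^ 2 = (Fintype.card F : ℝ) ^ d := by
  classical
  have h : ((‖quadSum d e s‖ ^ 2 : ℝ) : ℂ) = (((Fintype.card F : ℝ) ^ d : ℝ) : ℂ) := by
    rw [quadSum, ofReal_norm_sq_sum]
    simp only [← AddChar.map_neg_eq_conj, ← AddChar.map_add_eq_mul]
    rw [sum_comm]
    have h1 : ∀ y : Fin d → F, ∑ x, e (s * (x ⬝ᵥ x) + -(s * (y ⬝ᵥ y))) =
        ∑ u, e (s * (u ⬝ᵥ u)) * e (y ⬝ᵥ ((2 * s) • u)) := fun y => by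
      refine Fintype.sum_equiv (Equiv.subRight y) _ _ fun x => ?_
      rw [← AddChar.map_add_eq_mul]
      simp only [Equiv.subRight_apply, dotProduct_sub, sub_dotProduct, dotProduct_smul,
        smul_eq_mul, dotProduct_comm y x]
      congr 1
      ring
    simp only [h1]
    rw [sum_comm]
    simp only [← mul_sum]
    rw [sum_eq_single 0]
    · simp
    · intro u _ hu
      rw [sum_addChar_dotProduct_eq_zero he, mul_zero]
      exact smul_ne_zero (mul_ne_zero h2 hs) hu
    · simp
  exact_mod_cast h

theorem norm_quadSum (h2 : (2 : F) ≠ 0) {e : AddChar F ℂ} (he : e ≠ 1) {s : F} (hs : s ≠ 0) :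
    ‖quadSum d e s‖ = (Fintype.card F : ℝ) ^ ((d : ℝ) / 2) := by
  have h := norm_quadSum_sq (d := d) h2 he hs
  rw [← Real.sqrt_sq (norm_nonneg (quadSum d e s)), h, Real.sqrt_eq_rpow, ← Real.rpow_natCast,
    ← Real.rpow_mul (by positivity)]
  congr 1
  ring

/-- Fourier expansion of a quadratic phase, obtained by completing the square with coefficient
-1/(4s). -/
theorem addChar_mul_dotProduct_self (h2 : (2 : F) ≠ 0) {e : AddChar F ℂ} (he : e ≠ 1) {s : F}
    (hs : s ≠ 0) (z : Fin d → F) :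
    (Fintype.card F : ℂ) ^ d * e (s * (z ⬝ᵥ z)) =
      quadSum d e s * ∑ ξ : Fin d → F, e (z ⬝ᵥ ξ) * e (-(ξ ⬝ᵥ ξ) / (4 * s)) := by
  have h4 := four_ne_zero_of_two h2
  have hs' : -(4 * s)⁻¹ ≠ 0 := neg_ne_zero.mpr (inv_ne_zero (mul_ne_zero h4 hs))
  have h1 := sum_addChar_quadratic h2 e z hs'
  have h3 : ∀ ξ : Fin d → F, e (z ⬝ᵥ ξ) * e (-(ξ ⬝ᵥ ξ) / (4 * s)) =
      e (z ⬝ᵥ ξ + -(4 * s)⁻¹ * (ξ ⬝ᵥ ξ)) := fun ξ => by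
    rw [← AddChar.map_add_eq_mul]
    congr 2
    rw [neg_div, neg_mul, div_eq_inv_mul]
  simp only [h3, h1]
  -- Since -1/(4s) is -s times a square, its Gauss sum is the conjugate of the one at s, and their
  -- product is q^d.
  have h5 : -(4 * s)⁻¹ = -s * ((2 * s)⁻¹) ^ 2 := by field_simp; norm_num
  have h6 : -(z ⬝ᵥ z) / (4 * -(4 * s)⁻¹) = s * (z ⬝ᵥ z) := by field_simp
  rw [h6, h5, quadSum_mul_sq _ _ (inv_ne_zero (mul_ne_zero h2 hs)), ← conj_quadSum, ← mul_assoc,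
    Complex.mul_conj', ← Complex.ofReal_pow, norm_quadSum_sq h2 he hs]
  push_cast
  ring

theorem quadSum_eq_pow (e : AddChar F ℂ) (s : F) :
    quadSum d e s = (∑ x, e (s * x ^ 2)) ^ d := by
  classical
  rw [← Fin.prod_const, prod_univ_sum]
  simp only [Fintype.piFinset_univ, quadSum]
  refine sum_congr rfl fun γ _ => ?_
  rw [dotProduct, mul_sum]
  simp only [← pow_two]
  induction (univ : Finset (Fin d)) using Finset.induction_on with
  | empty => simp
  | insert i t hi ih => rw [sum_insert hi, prod_insert hi, AddChar.map_add_eq_mul, ih]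

variable (F) in
/-- The quadratic character of `F` with complex values. -/
noncomputable def complexQuadraticChar : MulChar F ℂ := by
  classical exact (quadraticChar F).ringHomComp (Int.castRingHom ℂ)

/-- An element a has 1 + χ(a) square roots, χ being the quadratic character; the constant 1 sums to
zero. -/
theorem sum_addChar_mul_sq (hF : ringChar F ≠ 2) {e : AddChar F ℂ} (he : e ≠ 1) {s : F}
    (hs : s ≠ 0) :
    ∑ x, e (s * x ^ 2) = complexQuadraticChar F s * gaussSum (complexQuadraticChar F) e := by
  classical
  have h1 : ∑ x, e (s * x ^ 2) = ∑ a : F, (1 + complexQuadraticChar F a) * e (s * a) := by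
    rw [← sum_fiberwise (g := fun x : F => x ^ 2)]
    refine sum_congr rfl fun a _ => ?_
    have h2 := quadraticChar_card_sqrts hF a
    have h3 : ∑ x with x ^ 2 = a, e (s * x ^ 2) = ∑ x : F with x ^ 2 = a, e (s * a) :=
      sum_congr rfl fun x hx => by rw [(mem_filter.mp hx).2]
    have h4 : {x : F | x ^ 2 = a}.toFinset = univ.filter fun x : F => x ^ 2 = a := by
      ext; simp
    rw [h3, sum_const, nsmul_eq_mul]
    congr 1
    rw [h4] at h2
    have h5 : ((#{x : F | x ^ 2 = a} : ℤ) : ℂ) = ((quadraticChar F a + 1 : ℤ) : ℂ) := by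
      rw [h2]
    push_cast at h5
    rw [h5, add_comm, complexQuadraticChar]
    simp [MulChar.ringHomComp_apply]
  have h6 : ∑ a, e (s * a) = 0 := by
    simpa only [mul_comm] using sum_addChar_mul_eq_zero he hs
  have h7 := gaussSum_mulShift (complexQuadraticChar F) e (Units.mk0 s hs)
  have hsq : complexQuadraticChar F s * complexQuadraticChar F s = 1 := by
    rw [complexQuadraticChar, ← map_mul, ← pow_two, MulChar.ringHomComp_apply,
      quadraticChar_sq_one' hs]
    simp
  rw [h1]
  simp only [add_mul, one_mul, sum_add_distrib, h6, zero_add]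
  rw [← h7, Units.val_mk0, ← mul_assoc, hsq, one_mul]
  rfl

theorem gaussSum_complexQuadraticChar_sq (hF : ringChar F ≠ 2) {e : AddChar F ℂ} (he : e ≠ 1) :
    gaussSum (complexQuadraticChar F) e ^ 2 = complexQuadraticChar F (-1) * Fintype.card F := by
  classical
  refine gaussSum_sq ?_ ?_ (AddChar.IsPrimitive.of_ne_one he)
  · rw [complexQuadraticChar]
    intro h
    obtain ⟨a, ha⟩ := quadraticChar_exists_neg_one' hF
    have h1 := congrArg (fun χ : MulChar F ℂ => χ a) h
    simp only [MulChar.ringHomComp_apply, ha, MulChar.one_apply_coe] at h1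
    norm_num at h1
  · rw [complexQuadraticChar]
    exact (quadraticChar_isQuadratic F).comp _

end CharacterSums

/-! ### Pairs with isotropic difference -/

section Isotropic

variable {F : Type*} [Field F] [Fintype F] {d : ℕ}

theorem complexQuadraticChar_sq {s : F} (hs : s ≠ 0) : complexQuadraticChar F s ^ 2 = 1 := by
  classical
  rw [complexQuadraticChar, ← map_pow, MulChar.ringHomComp_apply, quadraticChar_sq_one' hs]
  simp

theorem norm_complexQuadraticChar {s : F} (hs : s ≠ 0) : ‖complexQuadraticChar F s‖ = 1 := by
  have h : ‖complexQuadraticChar F s‖ ^ 2 = 1 := by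
    rw [← norm_pow, complexQuadraticChar_sq hs, norm_one]
  exact (pow_eq_one_iff_of_nonneg (norm_nonneg _) two_ne_zero).mp h

theorem norm_gaussSum_complexQuadraticChar (hF : ringChar F ≠ 2) {e : AddChar F ℂ} (he : e ≠ 1) :
    ‖gaussSum (complexQuadraticChar F) e‖ = √(Fintype.card F) := by
  have h := congrArg norm (gaussSum_complexQuadraticChar_sq hF he)
  rw [norm_pow, norm_mul, norm_complexQuadraticChar (neg_ne_zero.mpr one_ne_zero), one_mul,
    Complex.norm_natCast] at h
  rw [← h, Real.sqrt_sq (norm_nonneg _)]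

theorem norm_sum_quadraticChar_mul_le (hF : ringChar F ≠ 2) {e : AddChar F ℂ} (he : e ≠ 1)
    (t : F) : ‖∑ s, complexQuadraticChar F s * e (t * s)‖ ≤ √(Fintype.card F) := by
  classical
  rcases eq_or_ne t 0 with rfl | ht
  · have h : ∑ s : F, complexQuadraticChar F s = 0 := by
      have := quadraticChar_sum_zero hF
      have h1 := congrArg (Int.cast : ℤ → ℂ) this
      push_cast at h1
      simpa [complexQuadraticChar, MulChar.ringHomComp_apply] using h1
    simp [h]
  · have h1 := congrArg norm (gaussSum_mulShift (complexQuadraticChar F) e (Units.mk0 t ht))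
    rw [norm_mul, Units.val_mk0, norm_complexQuadraticChar ht, one_mul,
      norm_gaussSum_complexQuadraticChar hF he] at h1
    exact h1.le

open Classical in
theorem sum_ne_zero_inv {M : Type*} [AddCommMonoid M] (f : F → M) :
    ∑ s with s ≠ 0, f s⁻¹ = ∑ s with s ≠ 0, f s := by
  refine sum_nbij' (fun s => s⁻¹) (fun s => s⁻¹) ?_ ?_ ?_ ?_ ?_ <;> simp

open Classical in
-- For odd d one factor χ(s) remains, so the sum over s is itself a Gauss sum: d + 1 factors of size
-- √q in all.
theorem norm_sum_quadSum_mul_le_of_odd (hF : ringChar F ≠ 2) {e : AddChar F ℂ} (he : e ≠ 1)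
    (hd : Odd d) (c : F) :
    ‖∑ s with s ≠ 0, quadSum d e s * e (-c / (4 * s))‖ ≤
      (Fintype.card F : ℝ) ^ (((d : ℝ) + 1) / 2) := by
  set G := gaussSum (complexQuadraticChar F) e
  have h1 : ∀ s ∈ univ.filter (fun s : F => s ≠ 0), quadSum d e s * e (-c / (4 * s)) =
      G ^ d * (complexQuadraticChar F s⁻¹ * e ((-c / 4) * s⁻¹)) := fun s hs => by
    have hs0 : s ≠ 0 := (mem_filter.mp hs).2
    have h2 : complexQuadraticChar F s⁻¹ = complexQuadraticChar F s := by
      have h3 := complexQuadraticChar_sq hs0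
      have h4 : complexQuadraticChar F s * complexQuadraticChar F s⁻¹ = 1 := by
        rw [← map_mul, mul_inv_cancel₀ hs0, map_one]
      have h5 : complexQuadraticChar F s ≠ 0 := fun h => by simp [h] at h4
      rw [pow_two] at h3
      exact mul_left_cancel₀ h5 (h4.trans h3.symm)
    rw [quadSum_eq_pow, sum_addChar_mul_sq hF he hs0, mul_pow, h2, div_mul_eq_div_div,
      div_eq_mul_inv (-c / 4)]
    obtain ⟨k, rfl⟩ := hd
    rw [pow_succ (complexQuadraticChar F s), pow_mul, complexQuadraticChar_sq hs0]
    ring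
  rw [sum_congr rfl h1, ← mul_sum,
    sum_ne_zero_inv fun s => complexQuadraticChar F s * e ((-c / 4) * s), norm_mul, norm_pow,
    norm_gaussSum_complexQuadraticChar hF he]
  have h6 : ∑ s with s ≠ 0, complexQuadraticChar F s * e ((-c / 4) * s) =
      ∑ s, complexQuadraticChar F s * e ((-c / 4) * s) := by
    refine sum_filter_of_ne fun s _ h hs => h ?_
    rw [hs, MulChar.map_zero, zero_mul]
  rw [h6]
  calc _ ≤ √(Fintype.card F : ℝ) ^ d * √(Fintype.card F : ℝ) := by
        gcongr
        exact norm_sum_quadraticChar_mul_le hF he _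
    _ = _ := by
      rw [← pow_succ, Real.sqrt_eq_rpow, ← Real.rpow_natCast, ← Real.rpow_mul (by positivity)]
      congr 1
      push_cast
      ring

/-- `F ^ d` with the dot product has odd dimension, or it has even dimension and is not a sum of
hyperbolic planes. -/
def IsNonhyperbolic (F : Type*) [Field F] (d : ℕ) : Prop :=
  Odd d ∨ ∃ k, d = 2 * k ∧ Odd k ∧ ¬ IsSquare (-1 : F)

open Classical in
-- In the even case `quadSum` equals -q^k for every s ≠ 0, because the squared Gauss sum is χ(-1)q =
-- -q and k is odd. The remaining sum over s is q - 1 or -1, so its large value carries a minus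
-- sign. Only an upper bound for the real part holds at this strength, and only that is needed.
theorem re_sum_quadSum_mul_le (hF : ringChar F ≠ 2) {e : AddChar F ℂ} (he : e ≠ 1)
    (hd : IsNonhyperbolic F d) (c : F) :
    (∑ s with s ≠ 0, quadSum d e s * e (-c / (4 * s))).re ≤
      (Fintype.card F : ℝ) ^ (((d : ℝ) + 1) / 2) := by
  rcases hd with hd | ⟨k, rfl, hk, hsq⟩
  · exact (Complex.re_le_norm _).trans (norm_sum_quadSum_mul_le_of_odd hF he hd c)
  have hQ : (1 : ℝ) ≤ Fintype.card F := by exact_mod_cast Fintype.card_pos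
  have hη : complexQuadraticChar F (-1) = -1 := by
    rw [complexQuadraticChar, MulChar.ringHomComp_apply,
      quadraticChar_neg_one_iff_not_isSquare.mpr hsq]
    simp
  have h1 : ∀ s ∈ univ.filter (fun s : F => s ≠ 0), quadSum (2 * k) e s * e (-c / (4 * s)) =
      -(Fintype.card F : ℂ) ^ k * e (s⁻¹ * (-c / 4)) := fun s hs => by
    have hs0 : s ≠ 0 := (mem_filter.mp hs).2
    rw [quadSum_eq_pow, sum_addChar_mul_sq hF he hs0, mul_pow, pow_mul, pow_mul,
      complexQuadraticChar_sq hs0, gaussSum_complexQuadraticChar_sq hF he, hη, one_pow, one_mul,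
      mul_pow, hk.neg_one_pow, div_mul_eq_div_div, div_eq_inv_mul (-c / 4)]
    ring
  obtain ⟨r, hr, hr1⟩ : ∃ r : ℝ, ∑ s with s ≠ 0, e (s * (-c / 4)) = r ∧ -1 ≤ r := by
    rw [filter_ne' univ (0 : F), sum_erase_eq_sub (mem_univ _)]
    rcases eq_or_ne (-c / 4) 0 with h0 | h0
    · exact ⟨Fintype.card F - 1, by simp [h0], by linarith⟩
    · exact ⟨-1, by simp [sum_addChar_mul_eq_zero he h0], le_rfl⟩
  rw [sum_congr rfl h1, ← mul_sum, sum_ne_zero_inv fun s => e (s * (-c / 4)), hr]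
  have h2 : (-(Fintype.card F : ℂ) ^ k * (r : ℂ)).re = -(Fintype.card F : ℝ) ^ k * r := by
    rw [← Complex.ofReal_natCast, ← Complex.ofReal_pow, ← Complex.ofReal_neg, ← Complex.ofReal_mul,
      Complex.ofReal_re]
  rw [h2]
  calc -(Fintype.card F : ℝ) ^ k * r ≤ (Fintype.card F : ℝ) ^ k := by
        nlinarith [pow_pos (zero_lt_one.trans_le hQ) k]
    _ = (Fintype.card F : ℝ) ^ (k : ℝ) := (Real.rpow_natCast _ _).symm
    _ ≤ _ := Real.rpow_le_rpow_of_exponent_le hQ (by push_cast; linarith)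

open Classical in
/-- The number of pairs in `A` with isotropic difference. -/
noncomputable def isotropicPairs (A : Finset (Fin d → F)) : ℕ :=
  #{p ∈ A ×ˢ A | (p.1 - p.2) ⬝ᵥ (p.1 - p.2) = 0}

open Classical in
-- The condition (x - y)·(x - y) = 0 is detected by an average over s of e(s(x - y)·(x - y)), and
-- each phase with s ≠ 0 is expanded in characters.
theorem isotropicPairs_le (hF : ringChar F ≠ 2) {e : AddChar F ℂ} (he : e ≠ 1)
    (hd : IsNonhyperbolic F d) (A : Finset (Fin d → F)) :
    (isotropicPairs A : ℝ) ≤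
      (#A : ℝ) ^ 2 / Fintype.card F + (Fintype.card F : ℝ) ^ (((d : ℝ) - 1) / 2) * #A := by
  have h2 : (2 : F) ≠ 0 := Ring.two_ne_zero hF
  set Q := Fintype.card F with hQdef
  have hQ : (0 : ℝ) < Q := by exact_mod_cast Fintype.card_pos
  set W : F → ℂ := fun c => ∑ s with s ≠ 0, quadSum d e s * e (-c / (4 * s)) with hW
  set a : (Fin d → F) → ℝ := fun ξ => ‖∑ x, (if x ∈ A then 1 else 0) * e (x ⬝ᵥ ξ)‖ ^ 2 with ha
  have hcount : (Q : ℂ) * isotropicPairs A =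
      ∑ s, ∑ x ∈ A, ∑ y ∈ A, e (s * ((x - y) ⬝ᵥ (x - y))) := by
    rw [isotropicPairs, card_filter, sum_product]
    push_cast
    rw [mul_sum, sum_comm]
    refine sum_congr rfl fun x _ => ?_
    rw [mul_sum, sum_comm]
    refine sum_congr rfl fun y _ => ?_
    split_ifs with h
    · simp [h, hQdef]
    · rw [mul_zero, sum_addChar_mul_eq_zero he h]
  have ha' : ∀ ξ : Fin d → F, (a ξ : ℂ) = ∑ x ∈ A, ∑ y ∈ A, e ((x - y) ⬝ᵥ ξ) := fun ξ => by
    rw [ha]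
    simp only [ite_mul, one_mul, zero_mul, sum_ite_mem, univ_inter]
    rw [ofReal_norm_sq_sum]
    refine sum_congr rfl fun x _ => sum_congr rfl fun y _ => ?_
    rw [← AddChar.map_neg_eq_conj, ← AddChar.map_add_eq_mul, sub_dotProduct, sub_eq_add_neg]
  have hs : ∀ s ∈ univ.filter (fun s : F => s ≠ 0), (Q : ℂ) ^ d *
      ∑ x ∈ A, ∑ y ∈ A, e (s * ((x - y) ⬝ᵥ (x - y))) =
      ∑ ξ, (a ξ : ℂ) * (quadSum d e s * e (-(ξ ⬝ᵥ ξ) / (4 * s))) := fun s hs => by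
    have hs0 : s ≠ 0 := (mem_filter.mp hs).2
    simp only [ha', sum_mul]
    rw [mul_sum]
    refine Eq.trans (sum_congr rfl fun x _ => ?_) sum_comm
    rw [mul_sum]
    refine Eq.trans (sum_congr rfl fun y _ => ?_) sum_comm
    rw [addChar_mul_dotProduct_self h2 he hs0, mul_sum]
    exact sum_congr rfl fun ξ _ => by ring
  have htotal : (Q : ℂ) ^ d * (Q * isotropicPairs A) =
      (Q : ℂ) ^ d * (#A : ℂ) ^ 2 + ∑ ξ, (a ξ : ℂ) * W (ξ ⬝ᵥ ξ) := by
    -- The frequency s = 0 gives the main term |A|².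
    rw [hcount, ← sum_filter_add_sum_filter_not univ (fun s : F => s = 0), mul_add]
    congr 1
    · rw [sum_filter, sum_ite_eq', if_pos (mem_univ _)]
      simp [pow_two]
    · rw [mul_sum, sum_congr rfl hs, sum_comm]
      simp only [hW, mul_sum]
  have hre := congrArg Complex.re htotal
  have h5 : ((Q : ℂ) ^ d * (Q * isotropicPairs A)).re =
      (Q : ℝ) ^ d * (Q * isotropicPairs A) := by norm_cast
  have h6 : ((Q : ℂ) ^ d * (#A : ℂ) ^ 2).re = (Q : ℝ) ^ d * (#A : ℝ) ^ 2 := by norm_cast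
  rw [h5, Complex.add_re, h6, Complex.re_sum] at hre
  simp only [Complex.re_ofReal_mul] at hre
  -- The weights a ξ are nonnegative, so a one-sided bound for the real part of W suffices.
  have h7 : ∑ ξ, a ξ * (W (ξ ⬝ᵥ ξ)).re ≤ ∑ ξ, a ξ * (Q : ℝ) ^ (((d : ℝ) + 1) / 2) :=
    sum_le_sum fun ξ _ => mul_le_mul_of_nonneg_left
      (re_sum_quadSum_mul_le hF he hd _) (by positivity)
  have h8 : ∑ ξ, a ξ = (Q : ℝ) ^ d * #A := by
    simp only [ha]
    rw [sum_norm_sq_fourier he]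
    simp [hQdef, apply_ite norm]
  rw [← sum_mul, h8] at h7
  have h9 : (Q : ℝ) ^ (((d : ℝ) + 1) / 2) = Q * (Q : ℝ) ^ (((d : ℝ) - 1) / 2) := by
    rw [← Real.rpow_one_add' hQ.le]
    · congr 1; ring
    · have : (0 : ℝ) ≤ d := by positivity
      intro h
      linarith
  have hQd : (0 : ℝ) < (Q : ℝ) ^ d := by positivity
  have h10 : (Q : ℝ) * isotropicPairs A ≤ (#A : ℝ) ^ 2 +
      Q * (Q : ℝ) ^ (((d : ℝ) - 1) / 2) * #A := by
    rw [h9] at h7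
    have : (Q : ℝ) ^ d * (Q * isotropicPairs A) ≤ (Q : ℝ) ^ d * ((#A : ℝ) ^ 2 +
      Q * (Q : ℝ) ^ (((d : ℝ) - 1) / 2) * #A) := by
      rw [hre]; linarith
    exact le_of_mul_le_mul_left this hQd
  rw [div_add' _ _ _ hQ.ne', le_div_iff₀ hQ]
  linarith

end Isotropic

/-! ### Incidences and the energy of the lifted set -/

section Energy

variable {F : Type*} [Field F] {d : ℕ}

theorem exists_dotProduct_eq_one {x : Fin d → F} (hx : x ≠ 0) : ∃ u, x ⬝ᵥ u = 1 := by
  obtain ⟨i, hi⟩ := Function.ne_iff.mp hx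
  exact ⟨Pi.single i (x i)⁻¹, by rw [dotProduct_single, mul_inv_cancel₀ hi]⟩

open Classical in
/-- The number of pairs in `X ×ˢ Y` with dot product `1`. -/
noncomputable def unitPairs (X Y : Finset (Fin d → F)) : ℕ :=
  #{p ∈ X ×ˢ Y | p.1 ⬝ᵥ p.2 = 1}

section Incidence

variable [Fintype F]

open Classical in
theorem card_dotProduct_eq_one {x : Fin d → F} (hx : x ≠ 0) :
    Fintype.card F * #{y : Fin d → F | x ⬝ᵥ y = 1} = Fintype.card F ^ d := by
  obtain ⟨u, hu⟩ := exists_dotProduct_eq_one hx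
  have h : #((univ : Finset F) ×ˢ ({y : Fin d → F | x ⬝ᵥ y = 1} : Finset _)) =
      #(univ : Finset (Fin d → F)) := by
    refine card_nbij' (fun p => p.2 + p.1 • u)
      (fun z => (x ⬝ᵥ z - 1, z - (x ⬝ᵥ z - 1) • u)) ?_ ?_ ?_ ?_
    · simp [Set.MapsTo]
    · intro z _
      simp [dotProduct_sub, dotProduct_smul, hu]
    · rintro ⟨s, y⟩ hy
      have hy' : x ⬝ᵥ y = 1 := by simpa using hy
      simp [dotProduct_add, dotProduct_smul, hu, hy']
    · intro z _
      simp
  rw [card_product, card_univ, card_univ, Fintype.card_pi_const] at h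
  exact h

open Classical in
-- Two distinct hyperplanes of this form are disjoint or meet in codimension 2: if they meet, two
-- transversal directions w and y - w embed F² × (intersection) in F^d.
theorem card_dotProduct_eq_one_and_le {x x' : Fin d → F} (hx : x ≠ x') :
    Fintype.card F ^ 2 * #{y : Fin d → F | x ⬝ᵥ y = 1 ∧ x' ⬝ᵥ y = 1} ≤ Fintype.card F ^ d := by
  rcases ({y : Fin d → F | x ⬝ᵥ y = 1 ∧ x' ⬝ᵥ y = 1} : Finset _).eq_empty_or_nonempty with h | h
  · simp [h]
  obtain ⟨y, hy⟩ := h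
  obtain ⟨h1, h2⟩ := (mem_filter.mp hy).2
  obtain ⟨z, hz⟩ := exists_dotProduct_eq_one (sub_ne_zero.mpr hx)
  rw [sub_dotProduct] at hz
  set w := z - (x' ⬝ᵥ z) • y with hw
  have hw' : x' ⬝ᵥ w = 0 := by simp [hw, dotProduct_sub, dotProduct_smul, h2]
  have hw1 : x ⬝ᵥ w = 1 := by simp [hw, dotProduct_sub, dotProduct_smul, h1, hz]
  have h : #((univ : Finset (F × F)) ×ˢ
      ({y : Fin d → F | x ⬝ᵥ y = 1 ∧ x' ⬝ᵥ y = 1} : Finset _)) ≤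
      #(univ : Finset (Fin d → F)) := by
    refine card_le_card_of_injOn (fun p => p.2 + (p.1.1 • w + p.1.2 • (y - w)))
      (fun _ _ => mem_coe.mpr (mem_univ _)) ?_
    rintro ⟨⟨s, t⟩, a⟩ ha ⟨⟨s', t'⟩, a'⟩ ha' heq
    have ha1 : x ⬝ᵥ a = 1 ∧ x' ⬝ᵥ a = 1 := by simpa using ha
    have ha2 : x ⬝ᵥ a' = 1 ∧ x' ⬝ᵥ a' = 1 := by simpa using ha'
    have e1 := congrArg (fun v => x ⬝ᵥ v) heq
    have e2 := congrArg (fun v => x' ⬝ᵥ v) heq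
    simp only [dotProduct_add, dotProduct_smul, dotProduct_sub, ha1, ha2, hw', hw1, h1, h2,
      smul_eq_mul, sub_self, sub_zero, mul_zero, mul_one, add_zero, zero_add,
      add_right_inj] at e1 e2
    subst e1 e2
    simpa using heq
  rw [card_product, card_univ, card_univ, Fintype.card_pi_const, Fintype.card_prod, ← pow_two] at h
  exact h

open Classical in
-- Variance over y of the number of x in X with x·y = 1, centred at |X|/q. Covariances of distinct
-- x, x' are nonpositive, so only the diagonal contributes; Cauchy–Schwarz over Y finishes.
theorem unitPairs_sub_sq_le {X : Finset (Fin d → F)} (hX : (0 : Fin d → F) ∉ X)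
    (Y : Finset (Fin d → F)) :
    ((unitPairs X Y : ℝ) - #X * #Y / Fintype.card F) ^ 2 ≤
      #Y * (#X * ((Fintype.card F : ℝ) ^ d / Fintype.card F)) := by
  set Q : ℝ := (Fintype.card F : ℝ) with hQdef
  have hQ : 0 < Q := by rw [hQdef]; exact_mod_cast Fintype.card_pos
  set A : (Fin d → F) → (Fin d → F) → ℝ := fun x y => if x ⬝ᵥ y = 1 then 1 else 0 with hA
  have hA1 : ∀ x ∈ X, ∑ y, A x y = Q ^ d / Q := fun x hx => by
    have hx0 : x ≠ 0 := fun h => hX (h ▸ hx)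
    have h := card_dotProduct_eq_one hx0
    rw [eq_div_iff hQ.ne', mul_comm, hA]
    simp only [sum_boole]
    rw [hQdef]
    exact_mod_cast h
  have hA2 : ∀ x x', x ≠ x' → ∑ y, A x y * A x' y ≤ Q ^ d / Q / Q := fun x x' hx => by
    have h := card_dotProduct_eq_one_and_le hx
    rw [le_div_iff₀ hQ, le_div_iff₀ hQ, mul_assoc, mul_comm, ← pow_two, hA]
    simp only [mul_boole, ← ite_and, sum_boole]
    have h' : Q ^ 2 * (#{y : Fin d → F | x ⬝ᵥ y = 1 ∧ x' ⬝ᵥ y = 1} : ℝ) ≤ Q ^ d := by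
      rw [hQdef]
      exact_mod_cast h
    simpa only [and_comm] using h'
  have hmoment : ∑ y, (∑ x ∈ X, (A x y - 1 / Q)) ^ 2 ≤ #X * (Q ^ d / Q) := by
    have h1 : ∑ y, (∑ x ∈ X, (A x y - 1 / Q)) ^ 2 =
        ∑ x ∈ X, ∑ x' ∈ X, ∑ y, (A x y - 1 / Q) * (A x' y - 1 / Q) := by
      simp only [pow_two, sum_mul_sum]
      rw [sum_comm]
      exact sum_congr rfl fun x _ => sum_comm
    rw [h1]
    have h2 : ∀ x ∈ X, ∀ x' ∈ X, ∑ y, (A x y - 1 / Q) * (A x' y - 1 / Q) =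
        ∑ y, A x y * A x' y - Q ^ d / Q / Q := fun x hx x' hx' => by
      have h3 : ∀ y, (A x y - 1 / Q) * (A x' y - 1 / Q) =
          A x y * A x' y - A x y / Q - A x' y / Q + 1 / Q / Q := fun y => by ring
      simp only [h3, sum_add_distrib, sum_sub_distrib, ← sum_div, hA1 x hx, hA1 x' hx']
      simp [hQdef]
    calc _ ≤ ∑ x ∈ X, ∑ x' ∈ X, if x = x' then Q ^ d / Q else 0 := by
          refine sum_le_sum fun x hx => sum_le_sum fun x' hx' => ?_
          rw [h2 x hx x' hx']
          split_ifs with h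
          · subst h
            have h4 : ∀ y, A x y * A x y = A x y := fun y => by
              simp only [hA]; split_ifs <;> simp
            simp only [h4, hA1 x hx]
            have : 0 ≤ Q ^ d / Q / Q := by positivity
            linarith
          · linarith [hA2 x x' h]
      _ = _ := by simp
  have hsum : (unitPairs X Y : ℝ) - #X * #Y / Q = ∑ y ∈ Y, ∑ x ∈ X, (A x y - 1 / Q) := by
    rw [unitPairs, card_filter, sum_product_right]
    push_cast
    simp only [sum_sub_distrib, hA]
    simp
    ring
  rw [hsum]
  calc _ ≤ #Y * ∑ y ∈ Y, (∑ x ∈ X, (A x y - 1 / Q)) ^ 2 := sq_sum_le_card_mul_sum_sq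
    _ ≤ _ := by
      gcongr
      exact (sum_le_univ_sum_of_nonneg fun _ => sq_nonneg _).trans hmoment

theorem unitPairs_le {X Y : Finset (Fin d → F)} (hX : (0 : Fin d → F) ∉ X) {N : ℝ}
    (hXN : (#X : ℝ) ≤ N) (hYN : (#Y : ℝ) ≤ N) :
    (unitPairs X Y : ℝ) ≤
      N ^ 2 / Fintype.card F + (Fintype.card F : ℝ) ^ (((d : ℝ) - 1) / 2) * N := by
  have h := unitPairs_sub_sq_le hX Y
  set Q : ℝ := (Fintype.card F : ℝ) with hQdef
  have hQ : 0 < Q := by rw [hQdef]; exact_mod_cast Fintype.card_pos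
  have hN : 0 ≤ N := (Nat.cast_nonneg _).trans hXN
  have h1 : (Q ^ (((d : ℝ) - 1) / 2)) ^ 2 = Q ^ d / Q := by
    rw [← Real.rpow_natCast, ← Real.rpow_mul hQ.le, ← Real.rpow_natCast Q d]
    rw [← Real.rpow_sub_one hQ.ne']
    congr 1
    push_cast
    ring
  have h2 : #Y * (#X * (Q ^ d / Q)) ≤ (Q ^ (((d : ℝ) - 1) / 2) * N) ^ 2 := by
    rw [mul_pow, h1]
    calc #Y * (#X * (Q ^ d / Q)) ≤ N * (N * (Q ^ d / Q)) := by gcongr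
      _ = _ := by ring
  have h3 := abs_le_of_sq_le_sq (h.trans h2) (by positivity)
  have h4 : (#X : ℝ) * #Y / Q ≤ N ^ 2 / Q := by
    rw [pow_two]; gcongr
  linarith [(abs_le.mp h3).2]

open Classical in
-- In the plane distinct x, x' have at most one common y, so Cauchy–Schwarz gives I² ≤ N(N² + I) for
-- the number I of incidences.
theorem unitPairs_le_of_two {X Y : Finset (Fin 2 → F)} {N : ℝ} (hN : 1 ≤ N)
    (hXN : (#X : ℝ) ≤ N) (hYN : (#Y : ℝ) ≤ N) :
    (unitPairs X Y : ℝ) ≤ 2 * N ^ (3 / 2 : ℝ) := by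
  set A : (Fin 2 → F) → (Fin 2 → F) → ℝ := fun x y => if x ⬝ᵥ y = 1 then 1 else 0 with hA
  have hsum : (unitPairs X Y : ℝ) = ∑ y ∈ Y, ∑ x ∈ X, A x y := by
    rw [unitPairs, card_filter, sum_product_right]
    push_cast
    rfl
  have hoff : ∀ x x', x ≠ x' → ∑ y ∈ Y, A x y * A x' y ≤ 1 := fun x x' hx => by
    have h := Nat.le_of_mul_le_mul_left
      ((card_dotProduct_eq_one_and_le hx).trans (mul_one _).ge) (by positivity)
    refine (sum_le_univ_sum_of_nonneg fun y => ?_).trans (?_ : ∑ y, A x y * A x' y ≤ 1)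
    · simp only [hA]; split_ifs <;> simp
    · simp only [hA, mul_boole, ← ite_and, sum_boole]
      have h' : (#{y : Fin 2 → F | x ⬝ᵥ y = 1 ∧ x' ⬝ᵥ y = 1} : ℝ) ≤ 1 := by exact_mod_cast h
      simpa only [and_comm] using h'
  have h1 : ∑ y ∈ Y, (∑ x ∈ X, A x y) ^ 2 ≤ N ^ 2 + unitPairs X Y := by
    calc ∑ y ∈ Y, (∑ x ∈ X, A x y) ^ 2 = ∑ x ∈ X, ∑ x' ∈ X, ∑ y ∈ Y, A x y * A x' y := by
          simp only [pow_two, sum_mul_sum]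
          rw [sum_comm]
          exact sum_congr rfl fun x _ => sum_comm
      _ ≤ ∑ x ∈ X, ∑ x' ∈ X, (1 + if x = x' then ∑ y ∈ Y, A x y else 0) := by
          refine sum_le_sum fun x hx => sum_le_sum fun x' hx' => ?_
          split_ifs with h
          · subst h
            have h4 : ∀ y, A x y * A x y = A x y := fun y => by
              simp only [hA]; split_ifs <;> simp
            simp only [h4]
            linarith
          · linarith [hoff x x' h]
      _ = #X * #X + unitPairs X Y := by
          rw [hsum, sum_comm (s := Y)]
          simp [sum_add_distrib]
      _ ≤ _ := by rw [pow_two]; gcongr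
  set I : ℝ := (unitPairs X Y : ℝ) with hI
  have hI0 : 0 ≤ I := Nat.cast_nonneg _
  have h2 : I ^ 2 ≤ N * (N ^ 2 + I) := by
    calc I ^ 2 ≤ #Y * ∑ y ∈ Y, (∑ x ∈ X, A x y) ^ 2 := by
          rw [hsum]; exact sq_sum_le_card_mul_sum_sq
      _ ≤ _ := mul_le_mul hYN h1 (sum_nonneg fun _ _ => sq_nonneg _) (by linarith)
  set r := N ^ (3 / 2 : ℝ) with hr
  have hrsq : r ^ 2 = N ^ 3 := by
    rw [hr, ← Real.rpow_natCast, ← Real.rpow_mul (by linarith), ← Real.rpow_natCast]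
    norm_num
  have hNr : N ≤ r := by
    conv_lhs => rw [← Real.rpow_one N]
    exact Real.rpow_le_rpow_of_exponent_le hN (by norm_num)
  have hr0 : 0 ≤ r := by positivity
  by_contra! hcon
  have h3 : N * I ≤ r * I := mul_le_mul_of_nonneg_right hNr hI0
  nlinarith

end Incidence

open Classical in
/-- The additive energy of the lift of `E` to the paraboloid. -/
noncomputable def liftEnergy (E : Finset (Fin d → F)) : ℕ :=
  #{p ∈ (E ×ˢ E) ×ˢ (E ×ˢ E) | p.1.1 + p.1.2 = p.2.1 + p.2.2 ∧
    p.1.1 ⬝ᵥ p.1.1 + p.1.2 ⬝ᵥ p.1.2 = p.2.1 ⬝ᵥ p.2.1 + p.2.2 ⬝ᵥ p.2.2}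

theorem liftEnergy_le_card_pow (E : Finset (Fin d → F)) : liftEnergy E ≤ #E ^ 3 := by
  classical
  have h : liftEnergy E ≤ #((E ×ˢ E) ×ˢ E) := by
    refine card_le_card_of_injOn (fun p => (p.1, p.2.1)) (fun p hp => ?_) ?_
    · simp only [coe_filter, mem_product, Set.mem_ofPred_eq] at hp
      simp [hp]
    · rintro ⟨⟨a, b⟩, c, z⟩ hp ⟨⟨a', b'⟩, c', z'⟩ hp' heq
      simp only [coe_filter, mem_product, Set.mem_ofPred_eq, Prod.mk.injEq] at hp hp' heq
      obtain ⟨⟨rfl, rfl⟩, rfl⟩ := heq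
      have := hp.2.1.symm.trans hp'.2.1
      simpa using this
  simpa [card_product, pow_succ, mul_assoc] using h

open Classical in
/-- The number of pairs `(c, b)` in `E` such that `a, c, b` has a right angle at `c` and `c - a` is not
isotropic. -/
noncomputable def rightAngles (E : Finset (Fin d → F)) (a : Fin d → F) : ℕ :=
  #{p ∈ E ×ˢ E | (p.1 - a) ⬝ᵥ (p.1 - a) ≠ 0 ∧ (p.1 - a) ⬝ᵥ (p.2 - p.1) = 0}

open Classical in
-- Inversion about a: a right angle at c means (c - a)·(b - a) = (c - a)·(c - a), so the inverted
-- point φ c has dot product 1 with b - a.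
theorem exists_rightAngles_le_unitPairs (E : Finset (Fin d → F)) (a : Fin d → F) :
    ∃ X Y : Finset (Fin d → F), 0 ∉ X ∧ #X ≤ #E ∧ #Y ≤ #E ∧ rightAngles E a ≤ unitPairs X Y := by
  set φ : (Fin d → F) → Fin d → F := fun c => ((c - a) ⬝ᵥ (c - a))⁻¹ • (c - a) with hφ
  have hφ1 : ∀ c, (c - a) ⬝ᵥ (c - a) ≠ 0 → (φ c) ⬝ᵥ (c - a) = 1 := fun c hc => by
    rw [hφ, smul_dotProduct, smul_eq_mul, inv_mul_cancel₀ hc]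
  -- Inversion is an involution, so φ is injective on the points where it is used.
  have hinv : ∀ c, (c - a) ⬝ᵥ (c - a) ≠ 0 → (φ c ⬝ᵥ φ c)⁻¹ • φ c = c - a := fun c hc => by
    simp only [hφ, smul_dotProduct, dotProduct_smul, smul_smul, smul_eq_mul]
    rw [show ((((c - a) ⬝ᵥ (c - a))⁻¹ * (((c - a) ⬝ᵥ (c - a))⁻¹ * (c - a) ⬝ᵥ (c - a)))⁻¹ *
      ((c - a) ⬝ᵥ (c - a))⁻¹) = 1 by field_simp, one_smul]
  refine ⟨(E.filter fun c => (c - a) ⬝ᵥ (c - a) ≠ 0).image φ, E.image fun b => b - a, ?_,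
    card_image_le.trans (card_filter_le _ _), card_image_le, ?_⟩
  · intro h
    obtain ⟨c, hc, h0⟩ := mem_image.mp h
    have := hφ1 c (mem_filter.mp hc).2
    rw [h0, zero_dotProduct] at this
    exact zero_ne_one this
  · refine card_le_card_of_injOn (fun p => (φ p.1, p.2 - a)) ?_ ?_
    · rintro ⟨c, b⟩ hp
      simp only [coe_filter, mem_product, Set.mem_ofPred_eq] at hp
      obtain ⟨⟨hc, hb⟩, hne, h0⟩ := hp
      simp only [coe_filter, mem_product, Set.mem_ofPred_eq]
      refine ⟨⟨mem_image_of_mem _ (mem_filter.mpr ⟨hc, hne⟩), mem_image_of_mem _ hb⟩, ?_⟩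
      rw [← sub_add_sub_cancel b c a, dotProduct_add, hφ1 c hne, hφ, smul_dotProduct, h0]
      simp
    · rintro ⟨c, b⟩ hp ⟨c', b'⟩ hp' heq
      simp only [coe_filter, mem_product, Set.mem_ofPred_eq, Prod.mk.injEq] at hp hp' heq
      have h1 := hinv c hp.2.1
      rw [heq.1, hinv c' hp'.2.1] at h1
      simp only [Prod.mk.injEq]
      exact ⟨(sub_left_injective h1).symm, sub_left_injective heq.2⟩

open Classical in
-- A quadruple is determined by a, b, c. It is counted as a right angle at c if c - a is not
-- isotropic, and otherwise as an isotropic pair (c, a) with an arbitrary b.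
theorem liftEnergy_le_sum (h2 : (2 : F) ≠ 0) (E : Finset (Fin d → F)) :
    liftEnergy E ≤ ∑ a ∈ E, rightAngles E a + isotropicPairs E * #E := by
  set S := ({p ∈ (E ×ˢ E) ×ˢ (E ×ˢ E) | p.1.1 + p.1.2 = p.2.1 + p.2.2 ∧
    p.1.1 ⬝ᵥ p.1.1 + p.1.2 ⬝ᵥ p.1.2 = p.2.1 ⬝ᵥ p.2.1 + p.2.2 ⬝ᵥ p.2.2} : Finset _) with hS
  -- Eliminating z = a + b - c turns the quadratic equation into 2(c - a)·(b - c) = 0.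
  have hright : ∀ a b c z : Fin d → F, a + b = c + z → a ⬝ᵥ a + b ⬝ᵥ b = c ⬝ᵥ c + z ⬝ᵥ z →
      (c - a) ⬝ᵥ (b - c) = 0 := fun a b c z h h' => by
    obtain rfl : z = a + b - c := by rw [h]; abel
    simp only [dotProduct_add, dotProduct_sub, add_dotProduct, sub_dotProduct,
      dotProduct_comm b a, dotProduct_comm c a, dotProduct_comm c b] at h' ⊢
    have : 2 * (b ⬝ᵥ c - a ⬝ᵥ b - (c ⬝ᵥ c - a ⬝ᵥ c)) = 0 := by linear_combination h'
    exact (mul_eq_zero.mp this).resolve_left h2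
  have hmem : ∀ {p}, p ∈ S ↔ ((p.1.1 ∈ E ∧ p.1.2 ∈ E) ∧ p.2.1 ∈ E ∧ p.2.2 ∈ E) ∧
      p.1.1 + p.1.2 = p.2.1 + p.2.2 ∧
      p.1.1 ⬝ᵥ p.1.1 + p.1.2 ⬝ᵥ p.1.2 = p.2.1 ⬝ᵥ p.2.1 + p.2.2 ⬝ᵥ p.2.2 := fun {p} => by
    simp only [hS, mem_filter, mem_product]
  have hS1 : #{p ∈ S | (p.2.1 - p.1.1) ⬝ᵥ (p.2.1 - p.1.1) ≠ 0} ≤ ∑ a ∈ E, rightAngles E a := by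
    rw [card_eq_sum_card_fiberwise (f := fun p => p.1.1) (t := E)
      (fun p hp => (hmem.mp (mem_filter.mp hp).1).1.1.1)]
    refine sum_le_sum fun a _ => card_le_card_of_injOn (fun p => (p.2.1, p.1.2)) ?_ ?_
    · rintro ⟨⟨a', b⟩, c, z⟩ hp
      simp only [coe_filter, mem_filter, hmem, Set.mem_ofPred_eq] at hp
      obtain ⟨⟨⟨⟨⟨ha, hb⟩, hc, hz⟩, h, h'⟩, hne⟩, rfl⟩ := hp
      simp only [coe_filter, mem_product, Set.mem_ofPred_eq]
      exact ⟨⟨hc, hb⟩, hne, hright _ _ _ _ h h'⟩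
    · rintro ⟨⟨a', b⟩, c, z⟩ hp ⟨⟨a'', b'⟩, c', z'⟩ hp' heq
      simp only [coe_filter, mem_filter, hmem, Set.mem_ofPred_eq, Prod.mk.injEq] at hp hp' heq
      obtain ⟨rfl, rfl⟩ := heq
      obtain ⟨⟨⟨-, h, -⟩, -⟩, rfl⟩ := hp
      obtain ⟨⟨⟨-, h', -⟩, -⟩, rfl⟩ := hp'
      simpa using h.symm.trans h'
  have hS3 : #{p ∈ S | (p.2.1 - p.1.1) ⬝ᵥ (p.2.1 - p.1.1) = 0} ≤ isotropicPairs E * #E := by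
    rw [isotropicPairs, ← card_product]
    refine card_le_card_of_injOn (fun p => ((p.2.1, p.1.1), p.1.2)) ?_ ?_
    · rintro ⟨⟨a, b⟩, c, z⟩ hp
      simp only [coe_filter, hmem, Set.mem_ofPred_eq] at hp
      simp [-sub_dotProduct, -dotProduct_sub, hp]
    · rintro ⟨⟨a, b⟩, c, z⟩ hp ⟨⟨a', b'⟩, c', z'⟩ hp' heq
      simp only [coe_filter, hmem, Set.mem_ofPred_eq, Prod.mk.injEq] at hp hp' heq
      obtain ⟨⟨rfl, rfl⟩, rfl⟩ := heq
      simpa using hp.1.2.1.symm.trans hp'.1.2.1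
  have hsub : S ⊆ {p ∈ S | (p.2.1 - p.1.1) ⬝ᵥ (p.2.1 - p.1.1) ≠ 0} ∪
      {p ∈ S | (p.2.1 - p.1.1) ⬝ᵥ (p.2.1 - p.1.1) = 0} := fun p hp => by
    simp only [mem_union, mem_filter, hp, true_and]
    tauto
  have h := (card_le_card hsub).trans (card_union_le _ _)
  have : liftEnergy E = #S := rfl
  rw [this]
  omega

theorem liftEnergy_le [Fintype F] (hF : ringChar F ≠ 2) {e : AddChar F ℂ} (he : e ≠ 1)
    (hd : IsNonhyperbolic F d) (E : Finset (Fin d → F)) :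
    (liftEnergy E : ℝ) ≤ 2 * ((#E : ℝ) ^ 3 / Fintype.card F +
      (Fintype.card F : ℝ) ^ (((d : ℝ) - 1) / 2) * (#E : ℝ) ^ 2) := by
  have h := liftEnergy_le_sum (Ring.two_ne_zero hF) E
  have h' : (liftEnergy E : ℝ) ≤ ∑ a ∈ E, (rightAngles E a : ℝ) + isotropicPairs E * #E := by
    exact_mod_cast h
  have h1 : ∀ a ∈ E, (rightAngles E a : ℝ) ≤ (#E : ℝ) ^ 2 / Fintype.card F +
      (Fintype.card F : ℝ) ^ (((d : ℝ) - 1) / 2) * #E := fun a _ => by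
    obtain ⟨X, Y, hX, hXE, hYE, h2⟩ := exists_rightAngles_le_unitPairs E a
    exact (Nat.cast_le.mpr h2).trans
      (unitPairs_le hX (Nat.cast_le.mpr hXE) (Nat.cast_le.mpr hYE))
  have h3 := sum_le_sum h1
  rw [sum_const, nsmul_eq_mul] at h3
  have h4 := mul_le_mul_of_nonneg_right (isotropicPairs_le hF he hd E) (Nat.cast_nonneg (#E))
  refine h'.trans ((add_le_add h3 h4).trans (le_of_eq ?_))
  ring

/-- Without isotropic vectors the isotropic pairs are the diagonal, and the planar incidence bound
is summed over a ∈ E. -/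
theorem liftEnergy_le_of_anisotropic [Fintype F] (h2 : (2 : F) ≠ 0)
    (hF : ∀ x : Fin 2 → F, x ⬝ᵥ x = 0 → x = 0) (E : Finset (Fin 2 → F)) :
    (liftEnergy E : ℝ) ≤ 3 * (#E : ℝ) ^ (5 / 2 : ℝ) := by
  classical
  rcases E.eq_empty_or_nonempty with rfl | hE
  · have := liftEnergy_le_card_pow (∅ : Finset (Fin 2 → F))
    simp only [card_empty] at this
    have h0 : liftEnergy (∅ : Finset (Fin 2 → F)) = 0 := by omega
    rw [h0]
    simp
  have hN : (1 : ℝ) ≤ #E := by exact_mod_cast hE.card_pos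
  have h' : (liftEnergy E : ℝ) ≤ ∑ a ∈ E, (rightAngles E a : ℝ) + isotropicPairs E * #E := by
    exact_mod_cast liftEnergy_le_sum h2 E
  have h1 : ∀ a ∈ E, (rightAngles E a : ℝ) ≤ 2 * (#E : ℝ) ^ (3 / 2 : ℝ) := fun a _ => by
    obtain ⟨X, Y, hX, hXE, hYE, h2⟩ := exists_rightAngles_le_unitPairs E a
    exact (Nat.cast_le.mpr h2).trans
      (unitPairs_le_of_two hN (Nat.cast_le.mpr hXE) (Nat.cast_le.mpr hYE))
  have h3 := sum_le_sum h1
  rw [sum_const, nsmul_eq_mul] at h3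
  have h4 : isotropicPairs E ≤ #E := by
    refine card_le_card_of_injOn Prod.fst (fun p hp => ?_) ?_
    · exact (mem_product.mp (mem_filter.mp hp).1).1
    · rintro ⟨x, y⟩ hp ⟨x', y'⟩ hp' heq
      have e1 := sub_eq_zero.mp (hF _ (mem_filter.mp hp).2)
      have e2 := sub_eq_zero.mp (hF _ (mem_filter.mp hp').2)
      simp only at e1 e2 heq
      rw [← e1, ← e2, heq]
  have h5 : (#E : ℝ) ^ (5 / 2 : ℝ) = #E * (#E : ℝ) ^ (3 / 2 : ℝ) := by
    rw [← Real.rpow_one_add' (by positivity) (by norm_num)]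
    norm_num
  have h6 : (#E : ℝ) ≤ (#E : ℝ) ^ (3 / 2 : ℝ) := by
    conv_lhs => rw [← Real.rpow_one (#E : ℝ)]
    exact Real.rpow_le_rpow_of_exponent_le hN (by norm_num)
  have h7 : (isotropicPairs E : ℝ) * #E ≤ #E * (#E : ℝ) ^ (3 / 2 : ℝ) :=
    mul_le_mul (Nat.cast_le.mpr h4) h6 (by positivity) (by positivity)
  rw [h5]
  linarith

end Energy

/-! ### Norms on finite types and duality -/

section LrNorm

variable {X : Type*} [Fintype X]

/-- The `L ^ r` norm with respect to the counting measure of a finite type. -/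
noncomputable def lrNorm (r : ℝ) (f : X → ℂ) : ℝ := (∑ x, ‖f x‖ ^ r) ^ (1 / r)

theorem lrNorm_nonneg (r : ℝ) (f : X → ℂ) : 0 ≤ lrNorm r f :=
  Real.rpow_nonneg (sum_nonneg fun _ _ => by positivity) _

theorem lrNorm_zero {r : ℝ} (hr : 0 < r) : lrNorm r (0 : X → ℂ) = 0 := by
  have h : 1 / r ≠ 0 := by positivity
  simp [lrNorm, Real.zero_rpow hr.ne', hr.ne']

theorem lrNorm_add_le {r : ℝ} (hr : 1 ≤ r) (f g : X → ℂ) :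
    lrNorm r (f + g) ≤ lrNorm r f + lrNorm r g := by
  refine le_trans ?_ (Real.Lp_add_le_of_nonneg univ hr (fun x _ => norm_nonneg (f x))
    fun x _ => norm_nonneg (g x))
  refine Real.rpow_le_rpow (sum_nonneg fun _ _ => by positivity) ?_ (by positivity)
  exact sum_le_sum fun x _ => Real.rpow_le_rpow (norm_nonneg _) (norm_add_le _ _) (by linarith)

theorem lrNorm_sum_le {r : ℝ} (hr : 1 ≤ r) {ι : Type*} (s : Finset ι) (f : ι → X → ℂ) :
    lrNorm r (∑ i ∈ s, f i) ≤ ∑ i ∈ s, lrNorm r (f i) := by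
  classical
  induction s using Finset.induction_on with
  | empty => simp [lrNorm_zero (X := X) (zero_lt_one.trans_le hr)]
  | insert i s hi ih =>
    rw [sum_insert hi, sum_insert hi]
    exact (lrNorm_add_le hr _ _).trans (add_le_add_right ih _)

theorem lrNorm_smul {r : ℝ} (hr : 0 < r) {c : ℝ} (hc : 0 ≤ c) (f : X → ℂ) :
    lrNorm r (c • f) = c * lrNorm r f := by
  simp only [lrNorm, Pi.smul_apply, norm_smul, Real.norm_of_nonneg hc,
    Real.mul_rpow hc (norm_nonneg _)]
  rw [← mul_sum, Real.mul_rpow (by positivity) (sum_nonneg fun _ _ => by positivity),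
    ← Real.rpow_mul hc, mul_one_div_cancel hr.ne', Real.rpow_one]

theorem norm_sum_mul_le_lrNorm {r r' : ℝ} (h : r.HolderConjugate r') (f g : X → ℂ) :
    ‖∑ x, f x * g x‖ ≤ lrNorm r f * lrNorm r' g := by
  refine (norm_sum_le _ _).trans ?_
  simp only [norm_mul]
  exact Real.inner_le_Lp_mul_Lq_of_nonneg univ h (fun _ _ => norm_nonneg _)
    fun _ _ => norm_nonneg _

theorem lrNorm_pow_natCast {m : ℕ} (hm : m ≠ 0) (f : X → ℂ) :
    lrNorm m f ^ m = ∑ x, ‖f x‖ ^ m := by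
  rw [lrNorm, ← Real.rpow_natCast, ← Real.rpow_mul (sum_nonneg fun _ _ => by positivity),
    one_div_mul_cancel (by positivity), Real.rpow_one]
  simp only [Real.rpow_natCast]

theorem lrNorm_le_of_indicator {r : ℝ} (hr : 0 < r) (E : Finset X) (f : X → ℂ)
    (hf : ∀ x, ‖f x‖ ≤ 1) (hE : ∀ x, x ∉ E → f x = 0) : lrNorm r f ≤ (#E : ℝ) ^ (1 / r) := by
  refine Real.rpow_le_rpow (sum_nonneg fun _ _ => by positivity) ?_ (by positivity)
  rw [← sum_subset (subset_univ E) fun x _ hx => by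
    rw [hE x hx, norm_zero, Real.zero_rpow hr.ne']]
  calc _ ≤ ∑ x ∈ E, (1 : ℝ) := sum_le_sum fun x _ => Real.rpow_le_one (norm_nonneg _) (hf x) hr.le
    _ = _ := by simp

/-- Duality: a bound for an operator gives a bound for its transpose. -/
theorem lrNorm_le_of_transpose {Y : Type*} [Fintype Y] {r r' p p' : ℝ}
    (hr : r.HolderConjugate r') (hp : p.HolderConjugate p') {A : ℝ} (hA : 0 ≤ A)
    (f : X → ℂ) (R : Y → ℂ) (T : (Y → ℂ) → X → ℂ)
    (hadj : ∀ g : Y → ℂ, ∑ y, g y * R y = ∑ x, f x * T g x)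
    (hT : ∀ g, lrNorm r (T g) ≤ A * lrNorm p g) : lrNorm p' R ≤ A * lrNorm r' f := by
  set S := ∑ y, ‖R y‖ ^ p' with hS
  have hp' := hp.symm.lt
  have hp0 := hp.symm.pos
  have hS0 : 0 ≤ S := sum_nonneg fun _ _ => by positivity
  -- The extremal function for Hölder's inequality against R.
  set g : Y → ℂ := fun y => conj (R y) * ((‖R y‖ ^ (p' - 2) : ℝ) : ℂ) with hg
  have hgn : ∀ y, ‖g y‖ ^ p = ‖R y‖ ^ p' := fun y => by
    rcases eq_or_ne (R y) 0 with h0 | h0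
    · simp [hg, h0, Real.zero_rpow hp.pos.ne', Real.zero_rpow hp0.ne']
    · have h1 : 0 < ‖R y‖ := norm_pos_iff.mpr h0
      rw [hg, norm_mul, RCLike.norm_conj, Complex.norm_real, Real.norm_of_nonneg (by positivity),
        ← Real.rpow_one_add' h1.le (by linarith), ← Real.rpow_mul h1.le]
      congr 1
      have := hp.sub_one_mul_conj
      have := hp.symm.sub_one_mul_conj
      linarith
  have hsum : ∑ y, g y * R y = S := by
    rw [hS, Complex.ofReal_sum]
    refine sum_congr rfl fun y _ => ?_
    rcases eq_or_ne (R y) 0 with h0 | h0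
    · simp [hg, h0, Real.zero_rpow hp0.ne']
    · have h1 : 0 < ‖R y‖ := norm_pos_iff.mpr h0
      rw [hg, mul_right_comm, Complex.conj_mul', ← Complex.ofReal_pow, ← Complex.ofReal_mul,
        ← Real.rpow_natCast, ← Real.rpow_add h1]
      congr 2
      push_cast
      ring
  have h1 : S ≤ lrNorm r' f * (A * S ^ (1 / p)) := by
    calc S = ‖∑ x, f x * T g x‖ := by
          rw [← hadj, hsum, Complex.norm_real, Real.norm_of_nonneg hS0]
      _ ≤ lrNorm r' f * lrNorm r (T g) := norm_sum_mul_le_lrNorm hr.symm _ _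
      _ ≤ lrNorm r' f * (A * lrNorm p g) := by
          gcongr
          · exact lrNorm_nonneg _ _
          · exact hT g
      _ = _ := by rw [show lrNorm p g = S ^ (1 / p) by simp only [lrNorm, hgn, hS]]
  have hgoal : lrNorm p' R = S ^ (1 / p') := rfl
  rw [hgoal]
  rcases hS0.eq_or_lt with h0 | h0
  · rw [← h0, Real.zero_rpow (by positivity)]
    exact mul_nonneg hA (lrNorm_nonneg _ _)
  · have h2 : S = S ^ (1 / p') * S ^ (1 / p) := by
      rw [← Real.rpow_add h0, one_div, one_div, hp.symm.inv_add_inv_eq_one, Real.rpow_one]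
    have h3 : 0 < S ^ (1 / p) := by positivity
    refine le_of_mul_le_mul_right ?_ h3
    rw [← h2]
    linarith

end LrNorm

/-! ### The L⁴ extension estimate -/

section Extension

variable {F : Type*} [Field F] [Fintype F] {d : ℕ}

theorem sum_addChar_prod_eq_zero {e : AddChar F ℂ} (he : e ≠ 1) {u : Fin d → F} {t : F}
    (h : ¬ (u = 0 ∧ t = 0)) : ∑ p : (Fin d → F) × F, e (p.1 ⬝ᵥ u + p.2 * t) = 0 := by
  rw [Fintype.sum_prod_type]
  simp only [AddChar.map_add_eq_mul, ← mul_sum, ← sum_mul]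
  rcases eq_or_ne u 0 with hu | hu
  · rw [sum_addChar_mul_eq_zero he fun ht => h ⟨hu, ht⟩, mul_zero]
  · rw [sum_addChar_dotProduct_eq_zero he hu, zero_mul]

/-- The extension operator of the paraboloid `{(γ, γ · γ)}`, with counting measure. -/
noncomputable def extension (e : AddChar F ℂ) (g : (Fin d → F) → ℂ) (p : (Fin d → F) × F) : ℂ :=
  ∑ γ, g γ * e (p.1 ⬝ᵥ γ + p.2 * (γ ⬝ᵥ γ))

theorem extension_add (e : AddChar F ℂ) (g h : (Fin d → F) → ℂ) :
    extension e (g + h) = extension e g + extension e h := by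
  funext p
  simp [extension, add_mul, sum_add_distrib]

theorem extension_smul (e : AddChar F ℂ) (c : ℝ) (g : (Fin d → F) → ℂ) :
    extension e (c • g) = c • extension e g := by
  funext p
  simp [extension, mul_sum, mul_assoc]

open Classical in
-- Expanding the fourth power and summing over p, orthogonality keeps exactly the quadruples counted
-- by `liftEnergy`, each with a coefficient of modulus at most 1.
theorem sum_norm_extension_pow_four_le {e : AddChar F ℂ} (he : e ≠ 1) (E : Finset (Fin d → F))
    (g : (Fin d → F) → ℂ) (hg : ∀ x, ‖g x‖ ≤ 1) (hE : ∀ x, x ∉ E → g x = 0) :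
    ∑ p, ‖extension e g p‖ ^ 4 ≤ (Fintype.card F : ℝ) ^ (d + 1) * liftEnergy E := by
  set G : ((Fin d → F) × (Fin d → F)) → ℂ := fun q => g q.1 * g q.2 with hG
  set u : ((Fin d → F) × (Fin d → F)) → (Fin d → F) := fun q => q.1 + q.2 with hu
  set t : ((Fin d → F) × (Fin d → F)) → F := fun q => q.1 ⬝ᵥ q.1 + q.2 ⬝ᵥ q.2 with ht
  have hGn : ∀ q, ‖G q‖ ≤ 1 := fun q => by
    rw [hG, norm_mul]
    exact mul_le_one₀ (hg _) (norm_nonneg _) (hg _)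
  have hGE : ∀ q, q ∉ E ×ˢ E → G q = 0 := fun q hq => by
    rw [mem_product, not_and_or] at hq
    rcases hq with hq | hq <;> simp [hG, hE _ hq]
  have hsq : ∀ p, extension e g p ^ 2 = ∑ q ∈ E ×ˢ E, G q * e (p.1 ⬝ᵥ u q + p.2 * t q) :=
    fun p => by
      rw [sum_subset (subset_univ (E ×ˢ E)) fun q _ hq => by rw [hGE q hq, zero_mul], pow_two,
        extension, sum_mul_sum, Fintype.sum_prod_type]
      refine sum_congr rfl fun a _ => sum_congr rfl fun b _ => ?_
      rw [mul_mul_mul_comm, ← AddChar.map_add_eq_mul]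
      simp only [hG, hu, ht, dotProduct_add]
      congr 2
      ring
  have h1 : ((∑ p, ‖extension e g p‖ ^ 4 : ℝ) : ℂ) =
      ∑ q ∈ E ×ˢ E, ∑ q' ∈ E ×ˢ E, G q * conj (G q') *
        ∑ p : (Fin d → F) × F, e (p.1 ⬝ᵥ (u q - u q') + p.2 * (t q - t q')) := by
    rw [Complex.ofReal_sum]
    have h2 : ∀ p, ((‖extension e g p‖ ^ 4 : ℝ) : ℂ) = ∑ q ∈ E ×ˢ E, ∑ q' ∈ E ×ˢ E,
        G q * conj (G q') * e (p.1 ⬝ᵥ (u q - u q') + p.2 * (t q - t q')) := fun p => by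
      rw [show (4 : ℕ) = 2 * 2 from rfl, pow_mul, ← norm_pow, hsq, ofReal_norm_sq_sum]
      refine sum_congr rfl fun q _ => sum_congr rfl fun q' _ => ?_
      rw [map_mul, ← AddChar.map_neg_eq_conj, mul_mul_mul_comm, ← AddChar.map_add_eq_mul,
        dotProduct_sub]
      congr 2
      ring
    simp only [h2]
    rw [sum_comm]
    refine sum_congr rfl fun q _ => ?_
    rw [sum_comm]
    exact sum_congr rfl fun q' _ => (mul_sum _ _ _).symm
  have h3 : ∀ q q', ‖∑ p : (Fin d → F) × F, e (p.1 ⬝ᵥ (u q - u q') + p.2 * (t q - t q'))‖ =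
      if u q = u q' ∧ t q = t q' then (Fintype.card F : ℝ) ^ (d + 1) else 0 := fun q q' => by
    split_ifs with h
    · simp [h.1, h.2, pow_succ]
    · rw [sum_addChar_prod_eq_zero he, norm_zero]
      rwa [sub_eq_zero, sub_eq_zero]
  have hpos : (0 : ℝ) ≤ ∑ p, ‖extension e g p‖ ^ 4 := sum_nonneg fun _ _ => by positivity
  calc ∑ p, ‖extension e g p‖ ^ 4 = ‖((∑ p, ‖extension e g p‖ ^ 4 : ℝ) : ℂ)‖ := by
        rw [Complex.norm_real, Real.norm_of_nonneg hpos]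
    _ ≤ ∑ q ∈ E ×ˢ E, ∑ q' ∈ E ×ˢ E,
        if u q = u q' ∧ t q = t q' then (Fintype.card F : ℝ) ^ (d + 1) else 0 := by
      rw [h1]
      refine (norm_sum_le _ _).trans (sum_le_sum fun q _ => (norm_sum_le _ _).trans
        (sum_le_sum fun q' _ => ?_))
      rw [norm_mul, norm_mul, RCLike.norm_conj, h3]
      refine mul_le_of_le_one_left (by positivity)
        (mul_le_one₀ (hGn q) (norm_nonneg _) (hGn q'))
    _ = _ := by
      rw [← sum_product (E ×ˢ E) (E ×ˢ E) fun q => if u q.1 = u q.2 ∧ t q.1 = t q.2 then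
        (Fintype.card F : ℝ) ^ (d + 1) else 0, ← sum_filter, sum_const, nsmul_eq_mul, mul_comm]
      rfl

theorem lrNorm_extension_pow_four_le {e : AddChar F ℂ} (he : e ≠ 1) (E : Finset (Fin d → F))
    (g : (Fin d → F) → ℂ) (hg : ∀ x, ‖g x‖ ≤ 1) (hE : ∀ x, x ∉ E → g x = 0) :
    lrNorm 4 (extension e g) ^ 4 ≤ (Fintype.card F : ℝ) ^ (d + 1) * liftEnergy E := by
  have h := lrNorm_pow_natCast (m := 4) (by norm_num) (extension e g)
  push_cast at h
  rw [h]
  exact sum_norm_extension_pow_four_le he E g hg hE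

theorem le_two_mul_min_add {v x y z : ℝ} (hx : 0 ≤ x) (hy : 0 ≤ y) (hz : 0 ≤ z)
    (h1 : v ^ 4 ≤ x ^ 4) (h2 : v ^ 4 ≤ 2 * (z ^ 4 + y ^ 4)) : v ≤ 2 * (min x y + z) := by
  rcases le_total x y with h | h
  · rw [min_eq_left h]
    have := le_of_pow_le_pow_left₀ (by norm_num) hx h1
    linarith
  · rw [min_eq_right h]
    refine le_of_pow_le_pow_left₀ (n := 4) (by norm_num) (by positivity) (h2.trans ?_)
    have h3 : z ^ 4 ≤ (y + z) ^ 4 := pow_le_pow_left₀ hz (by linarith) 4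
    have h4 : y ^ 4 ≤ (y + z) ^ 4 := pow_le_pow_left₀ hy (by linarith) 4
    rw [mul_pow]
    linarith [pow_nonneg (add_nonneg hy hz) 4]

theorem rpow_mul_rpow_pow {Q N : ℝ} (hQ : 0 < Q) (hN : 0 ≤ N) (a α : ℝ) (m : ℕ) :
    (Q ^ a * N ^ α) ^ m = Q ^ (a * m) * N ^ (α * m) := by
  rw [mul_pow, ← Real.rpow_natCast, ← Real.rpow_natCast, ← Real.rpow_mul hQ.le,
    ← Real.rpow_mul hN]

/-- The extension estimate `L ^ (4n / (3n - 2)) → L ^ 4` for the paraboloid in `F ^ n`, where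
`n = d + 1`. -/
theorem exists_lrNorm_extension_le (d : ℕ) (hd2 : 2 ≤ d) (n : ℝ) (hn : n = d + 1) :
    ∃ C : ℝ, 0 ≤ C ∧ ∀ (F : Type*) [Field F] [Fintype F], ringChar F ≠ 2 → IsNonhyperbolic F d →
      ∀ e : AddChar F ℂ, e ≠ 1 → ∀ g : (Fin d → F) → ℂ,
        lrNorm 4 (extension e g) ≤ C * (Fintype.card F : ℝ) ^ ((n - 1) * (n + 2) / (4 * n)) *
          lrNorm (4 * n / (3 * n - 2)) g := by
  have hd2' : (2 : ℝ) ≤ d := by exact_mod_cast hd2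
  have hn3 : 3 ≤ n := by linarith
  have hn0 : 0 < n := by linarith
  -- On a logarithmic scale ρ is the slope of the line through the values of the energy bound at N =
  -- q^((n-2)/2), where N³ = q^((d-1)/2)N², and at N = q^(n-1), all of F^d.
  set ρ : ℝ := (3 * n - 2) / (4 * n) with hρ
  have hρ0 : 0 < ρ := div_pos (by linarith) (by linarith)
  have hρ' : 1 / ρ = 4 * n / (3 * n - 2) := by rw [hρ, one_div_div]
  have hα : ρ < 3 / 4 := by rw [hρ, div_lt_div_iff₀ (by linarith) (by norm_num)]; linarith
  have hβ : 1 / 2 < ρ := by rw [hρ, div_lt_div_iff₀ (by norm_num) (by linarith)]; linarith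
  -- Index `true` is the competition between N³ and q^((d-1)/2)N². Index `false` is the term N³/q;
  -- its partner is chosen to balance it and is never smaller for N ≤ q^(n-1), as `hz` shows.
  obtain ⟨C, hC, H⟩ := exists_strong_type_of_restricted_type (univ : Finset Bool) hρ0
    (fun _ => 3 / 4) (fun _ => 1 / 2)
    (fun i => if i then -(n - 2) / (4 * n) else -(n - 1) / (2 * n))
    (fun i => if i then (n - 2) ^ 2 / (8 * n) else (n - 1) * (n - 2) / (4 * n))
    (fun _ => by norm_num) (fun _ => hβ) (fun _ => hα) (fun i => by
      cases i <;> simp only [if_true, Bool.false_eq_true, if_false, hρ] <;>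
      · apply le_of_eq; field_simp; ring)
  refine ⟨2 * C, by positivity, fun F _ _ hF hH e he g => ?_⟩
  set Q : ℝ := (Fintype.card F : ℝ) with hQdef
  have hQ1 : 1 ≤ Q := by rw [hQdef]; exact_mod_cast Fintype.card_pos
  have hQ : 0 < Q := by linarith
  set c : ℝ := Q ^ (-((n - 1) * (n + 2) / (4 * n))) with hc
  have hc0 : 0 < c := by positivity
  have hmain := H Q 2 hQ1 (by norm_num) (Fin d → F) (fun g => c * lrNorm 4 (extension e g))
    (by
      have : extension e (0 : (Fin d → F) → ℂ) = 0 := by funext p; simp [extension]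
      rw [this, lrNorm_zero (by norm_num), mul_zero])
    (fun f g => by
      rw [extension_add, ← mul_add]
      exact mul_le_mul_of_nonneg_left (lrNorm_add_le (by norm_num) _ _) hc0.le)
    (fun r f hr => by rw [extension_smul, lrNorm_smul (by norm_num) hr]; ring)
    (fun E f hf hE => by
      have h4 := lrNorm_extension_pow_four_le he E f hf hE
      set N : ℝ := (#E : ℝ) with hN
      have hN0 : 0 ≤ N := Nat.cast_nonneg _
      have hNQ : N ≤ Q ^ (n - 1) := by
        have h := card_le_univ E
        rw [Fintype.card_pi_const] at h
        rw [hn, add_sub_cancel_right, Real.rpow_natCast, hN, hQdef]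
        exact_mod_cast h
      rw [Fintype.sum_bool]
      simp only [if_true, Bool.false_eq_true, if_false]
      have hz : Q ^ (-(n - 1) / (2 * n)) * N ^ (3 / 4 : ℝ) ≤
          Q ^ ((n - 1) * (n - 2) / (4 * n)) * N ^ (1 / 2 : ℝ) := by
        have h1 : N ^ (3 / 4 : ℝ) = N ^ (1 / 4 : ℝ) * N ^ (1 / 2 : ℝ) := by
          rw [← Real.rpow_add_of_nonneg hN0 (by norm_num) (by norm_num)]; norm_num
        have h2 : N ^ (1 / 4 : ℝ) ≤ Q ^ ((n - 1) / 4) := by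
          refine (Real.rpow_le_rpow hN0 hNQ (by norm_num)).trans (le_of_eq ?_)
          rw [← Real.rpow_mul hQ.le]; congr 1; ring
        rw [h1, ← mul_assoc]
        refine mul_le_mul_of_nonneg_right ?_ (by positivity)
        calc _ ≤ Q ^ (-(n - 1) / (2 * n)) * Q ^ ((n - 1) / 4) := by gcongr
          _ = _ := by rw [← Real.rpow_add hQ]; congr 1; field_simp; ring
      rw [min_eq_left hz]
      have hE1 : (liftEnergy E : ℝ) ≤ N ^ 3 := by
        rw [hN]
        exact_mod_cast liftEnergy_le_card_pow E
      have hE2 := liftEnergy_le hF he hH E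
      rw [← hQdef, ← hN] at hE2
      have hcQ : c ^ 4 * Q ^ (d + 1) = Q ^ (-(n - 2) / n) := by
        rw [hc, ← Real.rpow_natCast Q, ← Real.rpow_natCast, ← Real.rpow_mul hQ.le,
          ← Real.rpow_add hQ]
        push_cast
        rw [← hn]
        congr 1
        field_simp
        ring
      have hv : (c * lrNorm 4 (extension e f)) ^ 4 ≤ Q ^ (-(n - 2) / n) * liftEnergy E := by
        rw [mul_pow, ← hcQ, mul_assoc]
        exact mul_le_mul_of_nonneg_left h4 (by positivity)
      refine le_two_mul_min_add (by positivity) (by positivity) (by positivity) ?_ ?_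
      · refine hv.trans ?_
        rw [rpow_mul_rpow_pow hQ hN0]
        have e1 : -(n - 2) / (4 * n) * (4 : ℕ) = -(n - 2) / n := by push_cast; field_simp
        have e2 : N ^ ((3 / 4 : ℝ) * (4 : ℕ)) = N ^ 3 := by
          rw [← Real.rpow_natCast]; norm_num
        rw [e1, e2]
        gcongr
      · refine hv.trans ?_
        rw [rpow_mul_rpow_pow hQ hN0, rpow_mul_rpow_pow hQ hN0]
        have e1 : Q ^ (-(n - 1) / (2 * n) * (4 : ℕ)) = Q ^ (-(n - 2) / n) / Q := by
          rw [← Real.rpow_sub_one hQ.ne']; congr 1; push_cast; field_simp; ring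
        have e2 : N ^ ((3 / 4 : ℝ) * (4 : ℕ)) = N ^ 3 := by
          rw [← Real.rpow_natCast]; norm_num
        have e3 : Q ^ ((n - 2) ^ 2 / (8 * n) * (4 : ℕ)) =
            Q ^ (-(n - 2) / n) * Q ^ (((d : ℝ) - 1) / 2) := by
          rw [← Real.rpow_add hQ]
          congr 1
          rw [show (d : ℝ) = n - 1 by linarith]
          push_cast
          field_simp
          ring
        have e4 : N ^ ((1 / 2 : ℝ) * (4 : ℕ)) = N ^ 2 := by
          rw [← Real.rpow_natCast]; norm_num
        rw [e1, e2, e3, e4]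
        refine (mul_le_mul_of_nonneg_left hE2 (by positivity)).trans (le_of_eq ?_)
        ring) g
  have h5 : lrNorm (4 * n / (3 * n - 2)) g = (∑ x, ‖g x‖ ^ (1 / ρ)) ^ ρ := by
    rw [lrNorm, hρ', hρ, one_div_div]
  rw [h5]
  have h6 : Q ^ ((n - 1) * (n + 2) / (4 * n)) = c⁻¹ := by rw [hc, Real.rpow_neg hQ.le, inv_inv]
  rw [h6, mul_comm (2 * C), mul_assoc, ← div_eq_inv_mul, le_div_iff₀ hc0]
  linarith

end Extension

/-! ### The L² restriction norm and its decomposition into slices -/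

section Restriction

variable {F : Type*} [Field F] [Fintype F] {d : ℕ}

/-- The restriction of the Fourier transform to the paraboloid `{(γ, γ · γ)}`. -/
noncomputable def restriction (e : AddChar F ℂ) (f : (Fin d → F) × F → ℂ) (γ : Fin d → F) : ℂ :=
  ∑ p, f p * e (-(p.1 ⬝ᵥ γ + p.2 * (γ ⬝ᵥ γ)))

theorem restriction_add (e : AddChar F ℂ) (f g : (Fin d → F) × F → ℂ) :
    restriction e (f + g) = restriction e f + restriction e g := by
  funext p
  simp [restriction, add_mul, sum_add_distrib]

theorem restriction_smul (e : AddChar F ℂ) (c : ℝ) (f : (Fin d → F) × F → ℂ) :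
    restriction e (c • f) = c • restriction e f := by
  funext p
  simp [restriction, mul_sum, mul_assoc]

/-- Cauchy–Schwarz over the q slices p.2 = t, then Plancherel on each slice. -/
theorem sum_norm_restriction_sq_le {e : AddChar F ℂ} (he : e ≠ 1) (f : (Fin d → F) × F → ℂ) :
    ∑ γ, ‖restriction e f γ‖ ^ 2 ≤ (Fintype.card F : ℝ) ^ (d + 1) * ∑ p, ‖f p‖ ^ 2 := by
  have h1 : ∀ γ : Fin d → F, ‖restriction e f γ‖ ^ 2 ≤
      Fintype.card F * ∑ t, ‖∑ y, f (y, t) * e (y ⬝ᵥ (-γ))‖ ^ 2 := fun γ => by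
    have h2 : restriction e f γ =
        ∑ t, e (-(t * (γ ⬝ᵥ γ))) * ∑ y, f (y, t) * e (y ⬝ᵥ (-γ)) := by
      rw [restriction, Fintype.sum_prod_type_right]
      refine sum_congr rfl fun t _ => ?_
      rw [mul_sum]
      refine sum_congr rfl fun y _ => ?_
      rw [mul_left_comm, ← AddChar.map_add_eq_mul, dotProduct_neg]
      congr 2
      ring
    have h3 : ‖restriction e f γ‖ ≤ ∑ t, ‖∑ y, f (y, t) * e (y ⬝ᵥ (-γ))‖ := by
      rw [h2]
      refine (norm_sum_le _ _).trans (le_of_eq (sum_congr rfl fun t _ => ?_))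
      rw [norm_mul, AddChar.norm_apply, one_mul]
    calc _ ≤ (∑ t, ‖∑ y, f (y, t) * e (y ⬝ᵥ (-γ))‖) ^ 2 := by gcongr
      _ ≤ _ := by
        have := sq_sum_le_card_mul_sum_sq (s := (univ : Finset F))
          (f := fun t => ‖∑ y, f (y, t) * e (y ⬝ᵥ (-γ))‖)
        rwa [card_univ] at this
  calc _ ≤ ∑ γ : Fin d → F, Fintype.card F * ∑ t, ‖∑ y, f (y, t) * e (y ⬝ᵥ (-γ))‖ ^ 2 :=
        sum_le_sum fun γ _ => h1 γ
    _ = Fintype.card F * ∑ t, ∑ γ : Fin d → F, ‖∑ y, f (y, t) * e (y ⬝ᵥ γ)‖ ^ 2 := by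
        rw [← mul_sum, sum_comm]
        congr 1
        refine sum_congr rfl fun t _ => ?_
        exact Fintype.sum_equiv (Equiv.neg _) _ _ fun γ => rfl
    _ = _ := by
        simp only [sum_norm_sq_fourier he]
        rw [← mul_sum, ← mul_assoc, ← pow_succ', Fintype.sum_prod_type_right]

/-- The contribution of the slice `p.2 = t` of `f` to the convolution of `f` with the Fourier
transform of the normalized surface measure, away from that slice. -/
noncomputable def sliceConv (e : AddChar F ℂ) (f : (Fin d → F) × F → ℂ) (t : F)
    (q : (Fin d → F) × F) : ℂ := by
  classical exact if q.2 = t then 0 else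
    ((Fintype.card F : ℂ) ^ d)⁻¹ *
      ∑ y, f (y, t) * ∑ γ : Fin d → F, e ((q.1 - y) ⬝ᵥ γ + (q.2 - t) * (γ ⬝ᵥ γ))

/-- Expanding the square leaves a convolution kernel that is q^d times a delta at height 0; this
produces the diagonal term, and the other heights produce `sliceConv`. -/
theorem sum_norm_restriction_sq_eq {e : AddChar F ℂ} (he : e ≠ 1) (f : (Fin d → F) × F → ℂ) :
    ((∑ γ, ‖restriction e f γ‖ ^ 2 : ℝ) : ℂ) = (Fintype.card F : ℂ) ^ d *
      (∑ p, (‖f p‖ ^ 2 : ℂ) + ∑ q, conj (f q) * (∑ t, sliceConv e f t) q) := by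
  classical
  have hQ : (Fintype.card F : ℂ) ^ d ≠ 0 := pow_ne_zero _ (Nat.cast_ne_zero.mpr Fintype.card_ne_zero)
  have h1 : ∀ q : (Fin d → F) × F, ∑ t, ∑ y, f (y, t) *
      ∑ γ : Fin d → F, e ((q.1 - y) ⬝ᵥ γ + (q.2 - t) * (γ ⬝ᵥ γ)) =
      (Fintype.card F : ℂ) ^ d * (f q + (∑ t, sliceConv e f t) q) := fun q => by
    have h2 : (Fintype.card F : ℂ) ^ d * f q =
        ∑ t, if q.2 = t then (Fintype.card F : ℂ) ^ d * f q else 0 := by simp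
    rw [mul_add, h2, Finset.sum_apply, mul_sum, ← sum_add_distrib]
    refine sum_congr rfl fun t _ => ?_
    rw [sliceConv]
    split_ifs with h
    · subst h
      rw [sum_eq_single q.1]
      · simp [mul_comm]
      · intro y _ hy
        have : ∀ γ : Fin d → F, e ((q.1 - y) ⬝ᵥ γ + (q.2 - q.2) * (γ ⬝ᵥ γ)) =
            e (γ ⬝ᵥ (q.1 - y)) := fun γ => by
          rw [sub_self, zero_mul, add_zero, dotProduct_comm]
        simp only [this]
        rw [sum_addChar_dotProduct_eq_zero he (sub_ne_zero.mpr hy.symm), mul_zero]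
      · simp
    · rw [zero_add, mul_inv_cancel_left₀ hQ]
  rw [Complex.ofReal_sum]
  simp only [restriction, ofReal_norm_sq_sum]
  have h3 : ∑ γ : Fin d → F, ∑ p, ∑ q, f p * e (-(p.1 ⬝ᵥ γ + p.2 * (γ ⬝ᵥ γ))) *
      conj (f q * e (-(q.1 ⬝ᵥ γ + q.2 * (γ ⬝ᵥ γ)))) =
      ∑ q, conj (f q) * ∑ t, ∑ y, f (y, t) *
        ∑ γ : Fin d → F, e ((q.1 - y) ⬝ᵥ γ + (q.2 - t) * (γ ⬝ᵥ γ)) := by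
    rw [sum_comm]
    simp only [sum_comm (s := (univ : Finset (Fin d → F))) (t := (univ : Finset ((Fin d → F) × F)))]
    rw [sum_comm]
    refine sum_congr rfl fun q _ => ?_
    rw [Fintype.sum_prod_type_right, mul_sum]
    refine sum_congr rfl fun t _ => ?_
    rw [mul_sum]
    refine sum_congr rfl fun y _ => ?_
    rw [mul_sum, mul_sum]
    refine sum_congr rfl fun γ _ => ?_
    rw [map_mul, ← AddChar.map_neg_eq_conj, mul_mul_mul_comm, ← AddChar.map_add_eq_mul,
      sub_dotProduct, mul_comm (f (y, t)), mul_assoc]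
    congr 3
    ring
  rw [h3]
  simp only [h1]
  rw [mul_add, mul_sum, mul_sum, ← sum_add_distrib]
  refine sum_congr rfl fun q _ => ?_
  rw [← Complex.mul_conj']
  ring

/-- Away from its own height a slice is convolved with a Gaussian. Expanding (x - y)·(x - y)/(4s)
leaves a phase in x alone and the extension of the slice at (x/(2s), -1/(4s)). -/
theorem norm_sliceConv (h2 : (2 : F) ≠ 0) {e : AddChar F ℂ} (he : e ≠ 1)
    (f : (Fin d → F) × F → ℂ) {t : F} {q : (Fin d → F) × F} (hq : q.2 ≠ t) :
    ‖sliceConv e f t q‖ = (Fintype.card F : ℝ) ^ (-(d : ℝ) / 2) *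
      ‖extension e (fun y => f (y, t)) ((2 * (q.2 - t))⁻¹ • q.1, -(4 * (q.2 - t))⁻¹)‖ := by
  have hQ : (0 : ℝ) < Fintype.card F := by exact_mod_cast Fintype.card_pos
  have hs : q.2 - t ≠ 0 := sub_ne_zero.mpr hq
  set s := q.2 - t
  have h4 := four_ne_zero_of_two h2
  have h1 : ∑ y, f (y, t) * ∑ γ : Fin d → F, e ((q.1 - y) ⬝ᵥ γ + s * (γ ⬝ᵥ γ)) =
      quadSum d e s * e (-(q.1 ⬝ᵥ q.1) / (4 * s)) *
        extension e (fun y => f (y, t)) ((2 * s)⁻¹ • q.1, -(4 * s)⁻¹) := by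
    rw [extension, mul_sum]
    refine sum_congr rfl fun y _ => ?_
    rw [sum_addChar_quadratic h2 e _ hs, mul_left_comm, mul_assoc, mul_left_comm (e _) (f _),
      ← AddChar.map_add_eq_mul, ← mul_assoc, ← mul_assoc]
    congr 2
    simp only [dotProduct_sub, sub_dotProduct, smul_dotProduct, smul_eq_mul, dotProduct_comm y q.1]
    field_simp
    ring
  rw [sliceConv, if_neg hq, h1, norm_mul, norm_mul, norm_mul, AddChar.norm_apply, mul_one,
    norm_quadSum h2 he hs, norm_inv, norm_pow, Complex.norm_natCast, ← mul_assoc,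
    ← Real.rpow_natCast, ← Real.rpow_neg hQ.le, ← Real.rpow_add hQ]
  congr 2
  ring

open Classical in
/-- The slice of `G` at height `t`. -/
noncomputable def heightSlice (G : Finset ((Fin d → F) × F)) (t : F) : Finset (Fin d → F) :=
  {y | (y, t) ∈ G}

omit [Field F] in
theorem sum_card_heightSlice (G : Finset ((Fin d → F) × F)) : ∑ t, #(heightSlice G t) = #G := by
  classical
  simp only [heightSlice, card_filter]
  rw [← Fintype.sum_prod_type_right fun p : (Fin d → F) × F => if p ∈ G then 1 else 0]
  simp

/-- Power mean inequality over the q heights. -/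
theorem sum_card_heightSlice_rpow_le {θ : ℝ} (h0 : 0 < θ) (h1 : θ ≤ 1) (G : Finset ((Fin d → F) × F)) :
    ∑ t, (#(heightSlice G t) : ℝ) ^ θ ≤ (Fintype.card F : ℝ) ^ (1 - θ) * (#G : ℝ) ^ θ := by
  have h := Real.rpow_sum_le_const_mul_sum_rpow_of_nonneg (univ : Finset F)
    (f := fun t => (#(heightSlice G t) : ℝ) ^ θ) (p := 1 / θ) ((le_div_iff₀ h0).mpr (by linarith))
    fun _ _ => by positivity
  simp only [← Real.rpow_mul (Nat.cast_nonneg _), mul_one_div_cancel h0.ne', Real.rpow_one] at h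
  rw [← Nat.cast_sum, sum_card_heightSlice, card_univ] at h
  have h2 := Real.rpow_le_rpow (by positivity) h h0.le
  rw [← Real.rpow_mul (by positivity), one_div_mul_cancel h0.ne', Real.rpow_one,
    Real.mul_rpow (by positivity) (by positivity), ← Real.rpow_mul (by positivity)] at h2
  refine h2.trans (le_of_eq ?_)
  congr 2
  field_simp

/-- The change of points in `norm_sliceConv` is injective off the slice, so the L⁴ norm is at most
that of the extension over the whole space. -/
theorem lrNorm_sliceConv_pow_four_le (h2 : (2 : F) ≠ 0) {e : AddChar F ℂ} (he : e ≠ 1)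
    (G : Finset ((Fin d → F) × F)) (f : (Fin d → F) × F → ℂ) (hf : ∀ p, ‖f p‖ ≤ 1)
    (hG : ∀ p, p ∉ G → f p = 0) (t : F) :
    lrNorm 4 (sliceConv e f t) ^ 4 ≤
      (Fintype.card F : ℝ) ^ (1 - (d : ℝ)) * liftEnergy (heightSlice G t) := by
  classical
  have hQ : (0 : ℝ) < Fintype.card F := by exact_mod_cast Fintype.card_pos
  have h4 := four_ne_zero_of_two h2
  have hE := sum_norm_extension_pow_four_le he (heightSlice G t) (fun y => f (y, t)) (fun y => hf _)
    (fun y hy => hG _ (by simpa [heightSlice] using hy))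
  have h := lrNorm_pow_natCast (m := 4) (by norm_num) (sliceConv e f t)
  push_cast at h
  rw [h]
  set φ : (Fin d → F) × F → (Fin d → F) × F :=
    fun q => ((2 * (q.2 - t))⁻¹ • q.1, -(4 * (q.2 - t))⁻¹) with hφ
  have hinj : Set.InjOn φ (univ.filter fun q : (Fin d → F) × F => q.2 ≠ t) := by
    rintro ⟨x, s⟩ hx ⟨x', s'⟩ hx' heq
    have hs : s ≠ t := by simpa using hx
    have e2 : s = s' := by
      have := congrArg Prod.snd heq
      simpa [hφ, h4] using this
    subst e2
    have e1 := congrArg Prod.fst heq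
    simp only [hφ] at e1
    rw [smul_right_injective _ (inv_ne_zero (mul_ne_zero h2 (sub_ne_zero.mpr hs))) e1]
  have hc : ((Fintype.card F : ℝ) ^ (-(d : ℝ) / 2)) ^ 4 * (Fintype.card F : ℝ) ^ (d + 1) =
      (Fintype.card F : ℝ) ^ (1 - (d : ℝ)) := by
    rw [← Real.rpow_natCast, ← Real.rpow_natCast, ← Real.rpow_mul hQ.le, ← Real.rpow_add hQ]
    congr 1
    push_cast
    ring
  calc ∑ q, ‖sliceConv e f t q‖ ^ 4 = ∑ q with q.2 ≠ t, ‖sliceConv e f t q‖ ^ 4 := by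
        refine (sum_filter_of_ne (p := fun q : (Fin d → F) × F => q.2 ≠ t) ?_).symm
        intro q _ h hq
        exact h (by simp [sliceConv, hq])
    _ = ∑ q with q.2 ≠ t, ((Fintype.card F : ℝ) ^ (-(d : ℝ) / 2)) ^ 4 *
          ‖extension e (fun y => f (y, t)) (φ q)‖ ^ 4 := by
        refine sum_congr rfl fun q hq => ?_
        rw [norm_sliceConv h2 he f (mem_filter.mp hq).2, mul_pow]
    _ = ((Fintype.card F : ℝ) ^ (-(d : ℝ) / 2)) ^ 4 *
          ∑ p ∈ (univ.filter fun q : (Fin d → F) × F => q.2 ≠ t).image φ,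
            ‖extension e (fun y => f (y, t)) p‖ ^ 4 := by
        rw [← mul_sum, sum_image hinj]
    _ ≤ ((Fintype.card F : ℝ) ^ (-(d : ℝ) / 2)) ^ 4 *
          ∑ p, ‖extension e (fun y => f (y, t)) p‖ ^ 4 :=
        mul_le_mul_of_nonneg_left (sum_le_univ_sum_of_nonneg fun _ => by positivity) (by positivity)
    _ ≤ _ := by
        rw [← hc, mul_assoc]
        exact mul_le_mul_of_nonneg_left hE (by positivity)

theorem norm_sliceConv_le (h2 : (2 : F) ≠ 0) {e : AddChar F ℂ} (he : e ≠ 1)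
    (f : (Fin d → F) × F → ℂ) (t : F) (q : (Fin d → F) × F) :
    ‖sliceConv e f t q‖ ≤ (Fintype.card F : ℝ) ^ (-(d : ℝ) / 2) * ∑ y, ‖f (y, t)‖ := by
  by_cases hq : q.2 = t
  · simp only [sliceConv, hq, if_true, norm_zero]
    positivity
  · rw [norm_sliceConv h2 he f hq]
    refine mul_le_mul_of_nonneg_left ((norm_sum_le _ _).trans (le_of_eq ?_)) (by positivity)
    exact sum_congr rfl fun y _ => by rw [norm_mul, AddChar.norm_apply, mul_one]

/-- The `L ^ 2` norm of the restriction of the Fourier transform, with respect to the normalized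
surface measure. -/
noncomputable def restrictionNorm (e : AddChar F ℂ) (f : (Fin d → F) × F → ℂ) : ℝ :=
  (Fintype.card F : ℝ) ^ (-(d : ℝ) / 2) * lrNorm 2 (restriction e f)

theorem restrictionNorm_sq (e : AddChar F ℂ) (f : (Fin d → F) × F → ℂ) :
    restrictionNorm e f ^ 2 =
      ((Fintype.card F : ℝ) ^ d)⁻¹ * ∑ γ, ‖restriction e f γ‖ ^ 2 := by
  have hQ : (0 : ℝ) < Fintype.card F := by exact_mod_cast Fintype.card_pos
  have h := lrNorm_pow_natCast (m := 2) (by norm_num) (restriction e f)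
  push_cast at h
  rw [restrictionNorm, mul_pow, h, ← Real.rpow_natCast, ← Real.rpow_mul hQ.le,
    ← Real.rpow_natCast _ d, ← Real.rpow_neg hQ.le]
  congr 2
  push_cast
  ring

section Indicator

variable {e : AddChar F ℂ} (he : e ≠ 1) (G : Finset ((Fin d → F) × F))
  (f : (Fin d → F) × F → ℂ) (hf : ∀ p, ‖f p‖ ≤ 1) (hG : ∀ p, p ∉ G → f p = 0)

include hf hG

omit [Field F] in
theorem sum_norm_pow_le_card {m : ℕ} (hm : m ≠ 0) : ∑ p, ‖f p‖ ^ m ≤ #G := by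
  rw [← sum_subset (subset_univ G) fun x _ hx => by rw [hG x hx, norm_zero, zero_pow hm]]
  calc _ ≤ ∑ x ∈ G, (1 : ℝ) := sum_le_sum fun x _ => pow_le_one₀ (norm_nonneg _) (hf x)
    _ = _ := by simp

include he

theorem restrictionNorm_sq_le_card_mul : restrictionNorm e f ^ 2 ≤ Fintype.card F * #G := by
  have hQ : (0 : ℝ) < Fintype.card F := by exact_mod_cast Fintype.card_pos
  rw [restrictionNorm_sq, inv_mul_le_iff₀ (by positivity)]
  refine (sum_norm_restriction_sq_le he f).trans ?_
  rw [pow_succ, mul_assoc]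
  gcongr
  exact sum_norm_pow_le_card G f hf hG two_ne_zero

theorem restrictionNorm_sq_le_add : restrictionNorm e f ^ 2 ≤
    #G + ‖∑ q, conj (f q) * (∑ t, sliceConv e f t) q‖ := by
  have hQ : (0 : ℝ) < (Fintype.card F : ℝ) ^ d := by
    have : (0 : ℝ) < Fintype.card F := by exact_mod_cast Fintype.card_pos
    positivity
  rw [restrictionNorm_sq, inv_mul_le_iff₀ hQ]
  have h := congrArg norm (sum_norm_restriction_sq_eq he f)
  rw [Complex.norm_real, Real.norm_of_nonneg (sum_nonneg fun _ _ => by positivity), norm_mul,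
    norm_pow, Complex.norm_natCast] at h
  rw [h]
  refine mul_le_mul_of_nonneg_left ((norm_add_le _ _).trans (add_le_add_left ?_ _)) hQ.le
  have h1 : (∑ p, (‖f p‖ ^ 2 : ℂ)) = ((∑ p, ‖f p‖ ^ 2 : ℝ) : ℂ) := by push_cast; rfl
  rw [h1, Complex.norm_real, Real.norm_of_nonneg (sum_nonneg fun _ _ => by positivity)]
  exact sum_norm_pow_le_card G f hf hG two_ne_zero

/-- The Stein–Tomas estimate. -/
theorem restrictionNorm_sq_le_steinTomas (h2 : (2 : F) ≠ 0) : restrictionNorm e f ^ 2 ≤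
    #G + (Fintype.card F : ℝ) ^ (-(d : ℝ) / 2) * (#G : ℝ) ^ 2 := by
  refine (restrictionNorm_sq_le_add he G f hf hG).trans (add_le_add_right ?_ _)
  have hN := sum_norm_pow_le_card G f hf hG one_ne_zero
  simp only [pow_one] at hN
  have h1 : ∀ q, ‖(∑ t, sliceConv e f t) q‖ ≤ (Fintype.card F : ℝ) ^ (-(d : ℝ) / 2) * #G :=
    fun q => by
      rw [Finset.sum_apply]
      refine (norm_sum_le _ _).trans ((sum_le_sum fun t _ => norm_sliceConv_le h2 he f t q).trans ?_)
      rw [← mul_sum, ← Fintype.sum_prod_type_right fun p => ‖f p‖]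
      gcongr
  refine (norm_sum_le _ _).trans ?_
  calc _ ≤ ∑ q, ‖f q‖ * ((Fintype.card F : ℝ) ^ (-(d : ℝ) / 2) * #G) := by
        refine sum_le_sum fun q _ => ?_
        rw [norm_mul, RCLike.norm_conj]
        exact mul_le_mul_of_nonneg_left (h1 q) (norm_nonneg _)
    _ ≤ #G * ((Fintype.card F : ℝ) ^ (-(d : ℝ) / 2) * #G) := by
        rw [← sum_mul]
        gcongr
    _ = _ := by ring

/-- Hölder with exponents 4/3 and 4, and the triangle inequality over slices in L⁴. -/
theorem restrictionNorm_sq_le_of_slices (h2 : (2 : F) ≠ 0) {B : F → ℝ} (hB : ∀ t, 0 ≤ B t)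
    (h : ∀ t, (Fintype.card F : ℝ) ^ (1 - (d : ℝ)) * liftEnergy (heightSlice G t) ≤ B t ^ 4) :
    restrictionNorm e f ^ 2 ≤ #G + (#G : ℝ) ^ (3 / 4 : ℝ) * ∑ t, B t := by
  refine (restrictionNorm_sq_le_add he G f hf hG).trans (add_le_add_right ?_ _)
  have hconj : (4 / 3 : ℝ).HolderConjugate 4 := by
    rw [Real.holderConjugate_iff]; norm_num
  refine (norm_sum_mul_le_lrNorm hconj _ _).trans ?_
  have h1 : lrNorm (4 / 3) (fun q => conj (f q)) ≤ (#G : ℝ) ^ (3 / 4 : ℝ) := by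
    have := lrNorm_le_of_indicator (r := 4 / 3) (by norm_num) G (fun q => conj (f q))
      (fun q => by rw [RCLike.norm_conj]; exact hf q) (fun q hq => by rw [hG q hq, map_zero])
    norm_num at this ⊢
    exact this
  have h3 : lrNorm 4 (∑ t, sliceConv e f t) ≤ ∑ t, B t :=
    (lrNorm_sum_le (by norm_num) _ _).trans (sum_le_sum fun t _ =>
      le_of_pow_le_pow_left₀ (by norm_num) (hB t)
        ((lrNorm_sliceConv_pow_four_le h2 he G f hf hG t).trans (h t)))
  exact mul_le_mul h1 h3 (lrNorm_nonneg _ _) (by positivity)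

end Indicator

end Restriction

/-! ### Interpolating the L² restriction bounds -/

section RestrictionEstimate

theorem le_two_mul_add_min {v x z y : ℝ} (hx : 0 ≤ x) (hz : 0 ≤ z) (hy : 0 ≤ y)
    (h1 : v ^ 2 ≤ x ^ 2 + z ^ 2) (h2 : v ^ 2 ≤ x ^ 2 + 2 * y ^ 2) : v ≤ 2 * (x + min z y) := by
  rcases le_total z y with h | h
  · rw [min_eq_left h]
    exact le_of_pow_le_pow_left₀ two_ne_zero (by positivity) (by nlinarith [mul_nonneg hx hz])
  · rw [min_eq_right h]
    exact le_of_pow_le_pow_left₀ two_ne_zero (by positivity) (by nlinarith [mul_nonneg hx hy])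

/-- Here x is the diagonal contribution. If w or z beats its competitor, the corresponding simpler
bound is used; otherwise the energy bound with y and y' is. -/
theorem le_two_mul_add_min_add_min {v x w z y y' : ℝ} (hx : 0 ≤ x) (hw : 0 ≤ w) (hz : 0 ≤ z)
    (hy : 0 ≤ y) (hy' : 0 ≤ y') (h1 : v ^ 2 ≤ w ^ 2) (h2 : v ^ 2 ≤ x ^ 2 + z ^ 2)
    (h3 : v ^ 2 ≤ x ^ 2 + 2 * (y ^ 2 + y' ^ 2)) : v ≤ 2 * (x + min y w + min z y') := by
  rcases le_total w y with h | h
  · rw [min_eq_right h]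
    have h4 := le_of_pow_le_pow_left₀ two_ne_zero hw h1
    have h5 : 0 ≤ min z y' := le_min hz hy'
    linarith
  · rw [min_eq_left h]
    rcases le_total z y' with h' | h'
    · rw [min_eq_left h']
      exact le_of_pow_le_pow_left₀ two_ne_zero (by positivity)
        (by nlinarith [mul_nonneg hx hz, mul_nonneg hx hy, mul_nonneg hz hy])
    · rw [min_eq_right h']
      exact le_of_pow_le_pow_left₀ two_ne_zero (by positivity)
        (by nlinarith [mul_nonneg hx hy', mul_nonneg hx hy, mul_nonneg hy hy'])

theorem exists_restrictionNorm_le_of_indicator (d : ℕ) {ι : Type*} (J : Finset ι) {ρ : ℝ}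
    (hρ : 0 < ρ) (α β a b : ι → ℝ) (hβ : ∀ i, 0 ≤ β i) (hβρ : ∀ i, β i < ρ) (hα : ∀ i, ρ < α i)
    (hab : ∀ i, a i * (ρ - β i) + b i * (α i - ρ) ≤ 0) :
    ∃ C : ℝ, 0 ≤ C ∧ ∀ (F : Type*) [Field F] [Fintype F] (e : AddChar F ℂ),
      (∀ (G : Finset ((Fin d → F) × F)) (f : (Fin d → F) × F → ℂ), (∀ p, ‖f p‖ ≤ 1) →
        (∀ p, p ∉ G → f p = 0) → restrictionNorm e f ≤ 2 * ∑ i ∈ J,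
          min ((Fintype.card F : ℝ) ^ a i * (#G : ℝ) ^ α i)
            ((Fintype.card F : ℝ) ^ b i * (#G : ℝ) ^ β i)) →
      ∀ f : (Fin d → F) × F → ℂ, restrictionNorm e f ≤ C * lrNorm (1 / ρ) f := by
  obtain ⟨C, hC, H⟩ := exists_strong_type_of_restricted_type J hρ α β a b hβ hβρ hα hab
  refine ⟨2 * C, by positivity, fun F _ _ e h f => ?_⟩
  have hQ : (1 : ℝ) ≤ Fintype.card F := by exact_mod_cast Fintype.card_pos
  have := H (Fintype.card F) 2 hQ (by norm_num) ((Fin d → F) × F) (fun f => restrictionNorm e f)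
    (by
      have : restriction e (0 : (Fin d → F) × F → ℂ) = 0 := by funext p; simp [restriction]
      rw [restrictionNorm, this, lrNorm_zero (by norm_num), mul_zero])
    (fun f g => by
      rw [restrictionNorm, restriction_add, restrictionNorm, restrictionNorm, ← mul_add]
      exact mul_le_mul_of_nonneg_left (lrNorm_add_le (by norm_num) _ _) (by positivity))
    (fun r f hr => by
      rw [restrictionNorm, restriction_smul, lrNorm_smul (by norm_num) hr, restrictionNorm]; ring)
    h f
  rwa [lrNorm, one_div_one_div]

section Indicator

variable {F : Type*} [Field F] [Fintype F] {d : ℕ} {e : AddChar F ℂ}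

/-- The two terms of `liftEnergy_le` give two powers of the slice sizes, 3/4 and 1/2; summing over
slices costs q^(1/4) and q^(1/2) respectively. -/
theorem restrictionNorm_sq_le_of_isNonhyperbolic (hF : ringChar F ≠ 2) (he : e ≠ 1)
    (hd : IsNonhyperbolic F d) (G : Finset ((Fin d → F) × F))
    (f : (Fin d → F) × F → ℂ) (hf : ∀ p, ‖f p‖ ≤ 1) (hG : ∀ p, p ∉ G → f p = 0) :
    restrictionNorm e f ^ 2 ≤ #G + 2 *
      (((Fintype.card F : ℝ) ^ ((1 - (d : ℝ)) / 8) * (#G : ℝ) ^ (3 / 4 : ℝ)) ^ 2 +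
        ((Fintype.card F : ℝ) ^ ((5 - (d : ℝ)) / 16) * (#G : ℝ) ^ (5 / 8 : ℝ)) ^ 2) := by
  set Q : ℝ := (Fintype.card F : ℝ) with hQdef
  have hQ : 0 < Q := by rw [hQdef]; exact_mod_cast Fintype.card_pos
  set N : ℝ := (#G : ℝ) with hN
  have hN0 : 0 ≤ N := Nat.cast_nonneg _
  have h := restrictionNorm_sq_le_of_slices he G f hf hG (Ring.two_ne_zero hF)
    (B := fun t => 2 * (Q ^ (-(d : ℝ) / 4) * (#(heightSlice G t) : ℝ) ^ (3 / 4 : ℝ) +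
      Q ^ ((1 - (d : ℝ)) / 8) * (#(heightSlice G t) : ℝ) ^ (1 / 2 : ℝ)))
    (fun t => by positivity) (fun t => by
      have h1 := liftEnergy_le hF he hd (heightSlice G t)
      rw [← hQdef] at h1 ⊢
      set M : ℝ := (#(heightSlice G t) : ℝ) with hM
      have hM0 : 0 ≤ M := Nat.cast_nonneg _
      set x := Q ^ (-(d : ℝ) / 4) * M ^ (3 / 4 : ℝ) with hx
      set y := Q ^ ((1 - (d : ℝ)) / 8) * M ^ (1 / 2 : ℝ) with hy
      have hx0 : 0 ≤ x := by positivity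
      have hy0 : 0 ≤ y := by positivity
      have h3 : x ^ 4 ≤ (x + y) ^ 4 := pow_le_pow_left₀ hx0 (by linarith) 4
      have h4 : y ^ 4 ≤ (x + y) ^ 4 := pow_le_pow_left₀ hy0 (by linarith) 4
      have hx4 : x ^ 4 = Q ^ (1 - (d : ℝ)) * (M ^ 3 / Q) := by
        rw [hx, rpow_mul_rpow_pow hQ hM0, mul_div_left_comm, mul_comm (M ^ 3),
          ← Real.rpow_sub_one hQ.ne', ← Real.rpow_natCast M]
        congr 2 <;> · push_cast; ring
      have hy4 : y ^ 4 = Q ^ (1 - (d : ℝ)) * (Q ^ (((d : ℝ) - 1) / 2) * M ^ 2) := by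
        rw [hy, rpow_mul_rpow_pow hQ hM0, ← mul_assoc, ← Real.rpow_add hQ, ← Real.rpow_natCast M]
        congr 2 <;> · push_cast; ring
      refine (mul_le_mul_of_nonneg_left h1 (by positivity)).trans ?_
      have h5 : Q ^ (1 - (d : ℝ)) * (2 * (M ^ 3 / Q + Q ^ (((d : ℝ) - 1) / 2) * M ^ 2)) =
          2 * (x ^ 4 + y ^ 4) := by rw [hx4, hy4]; ring
      rw [h5, mul_pow]
      linarith [pow_nonneg (add_nonneg hx0 hy0) 4])
  refine h.trans (add_le_add_right ?_ _)
  rw [← mul_sum, sum_add_distrib, ← mul_sum, ← mul_sum, mul_left_comm]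
  have h1 := sum_card_heightSlice_rpow_le (θ := 3 / 4) (by norm_num) (by norm_num) G
  have h2 := sum_card_heightSlice_rpow_le (θ := 1 / 2) (by norm_num) (by norm_num) G
  rw [← hQdef, ← hN] at h1 h2
  refine mul_le_mul_of_nonneg_left ?_ zero_le_two
  calc _ ≤ N ^ (3 / 4 : ℝ) * (Q ^ (-(d : ℝ) / 4) * (Q ^ (1 - 3 / 4 : ℝ) * N ^ (3 / 4 : ℝ)) +
        Q ^ ((1 - (d : ℝ)) / 8) * (Q ^ (1 - 1 / 2 : ℝ) * N ^ (1 / 2 : ℝ))) := by gcongr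
    _ = (Q ^ (-(d : ℝ) / 4) * Q ^ (1 - 3 / 4 : ℝ)) * (N ^ (3 / 4 : ℝ) * N ^ (3 / 4 : ℝ)) +
        (Q ^ ((1 - (d : ℝ)) / 8) * Q ^ (1 - 1 / 2 : ℝ)) * (N ^ (3 / 4 : ℝ) * N ^ (1 / 2 : ℝ)) := by
        ring
    _ = _ := by
      rw [rpow_mul_rpow_pow hQ hN0, rpow_mul_rpow_pow hQ hN0, ← Real.rpow_add hQ,
        ← Real.rpow_add hQ, ← Real.rpow_add_of_nonneg hN0 (by norm_num) (by norm_num),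
        ← Real.rpow_add_of_nonneg hN0 (by norm_num) (by norm_num)]
      congr 3 <;> · push_cast; ring

theorem restrictionNorm_sq_le_of_anisotropic (h2 : (2 : F) ≠ 0) (he : e ≠ 1)
    (hF : ∀ x : Fin 2 → F, x ⬝ᵥ x = 0 → x = 0) (G : Finset ((Fin 2 → F) × F))
    (f : (Fin 2 → F) × F → ℂ) (hf : ∀ p, ‖f p‖ ≤ 1) (hG : ∀ p, p ∉ G → f p = 0) :
    restrictionNorm e f ^ 2 ≤ #G + 2 *
      ((Fintype.card F : ℝ) ^ (1 / 16 : ℝ) * (#G : ℝ) ^ (11 / 16 : ℝ)) ^ 2 := by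
  set Q : ℝ := (Fintype.card F : ℝ) with hQdef
  have hQ : 0 < Q := by rw [hQdef]; exact_mod_cast Fintype.card_pos
  set N : ℝ := (#G : ℝ) with hN
  have hN0 : 0 ≤ N := Nat.cast_nonneg _
  have h := restrictionNorm_sq_le_of_slices he G f hf hG h2
    (B := fun t => 2 * (Q ^ (-1 / 4 : ℝ) * (#(heightSlice G t) : ℝ) ^ (5 / 8 : ℝ)))
    (fun t => by positivity) (fun t => by
      have h1 := liftEnergy_le_of_anisotropic h2 hF (heightSlice G t)
      rw [← hQdef]
      set M : ℝ := (#(heightSlice G t) : ℝ) with hM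
      have hM0 : 0 ≤ M := Nat.cast_nonneg _
      rw [mul_pow, rpow_mul_rpow_pow hQ hM0]
      refine (mul_le_mul_of_nonneg_left h1 (by positivity)).trans ?_
      have e1 : (1 - ((2 : ℕ) : ℝ)) = -1 / 4 * ((4 : ℕ) : ℝ) := by norm_num
      have e2 : (5 / 2 : ℝ) = 5 / 8 * ((4 : ℕ) : ℝ) := by norm_num
      rw [e1, e2]
      have : 0 ≤ Q ^ (-1 / 4 * ((4 : ℕ) : ℝ)) * M ^ (5 / 8 * ((4 : ℕ) : ℝ)) := by positivity
      linarith)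
  refine h.trans (add_le_add_right ?_ _)
  rw [← mul_sum, ← mul_sum, mul_left_comm]
  have h1 := sum_card_heightSlice_rpow_le (θ := 5 / 8) (by norm_num) (by norm_num) G
  rw [← hQdef, ← hN] at h1
  refine mul_le_mul_of_nonneg_left ?_ zero_le_two
  calc _ ≤ N ^ (3 / 4 : ℝ) * (Q ^ (-1 / 4 : ℝ) * (Q ^ (1 - 5 / 8 : ℝ) * N ^ (5 / 8 : ℝ))) := by
        gcongr
    _ = (Q ^ (-1 / 4 : ℝ) * Q ^ (1 - 5 / 8 : ℝ)) * (N ^ (3 / 4 : ℝ) * N ^ (5 / 8 : ℝ)) := by ring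
    _ = _ := by
      rw [rpow_mul_rpow_pow hQ hN0, ← Real.rpow_add hQ,
        ← Real.rpow_add_of_nonneg hN0 (by norm_num) (by norm_num)]
      congr 2 <;> norm_num

theorem sq_rpow_half {N : ℝ} (hN : 0 ≤ N) : (N ^ (1 / 2 : ℝ)) ^ 2 = N := by
  rw [← Real.sqrt_eq_rpow, Real.sq_sqrt hN]

/-- Puts the diagonal term N^(1/2) in the form of a minimum, as the interpolation requires; N must
be an integer, so that N^(1/2) ≤ N. -/
theorem min_natCast_rpow_half {Q : ℝ} (N : ℕ) :
    min (Q ^ (0 : ℝ) * (N : ℝ) ^ (1 : ℝ)) (Q ^ (0 : ℝ) * (N : ℝ) ^ (1 / 2 : ℝ)) =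
      (N : ℝ) ^ (1 / 2 : ℝ) := by
  rw [Real.rpow_zero, one_mul, one_mul, min_eq_right]
  rcases Nat.eq_zero_or_pos N with rfl | h
  · norm_num
  · exact Real.rpow_le_rpow_of_exponent_le (by exact_mod_cast h) (by norm_num)

theorem rpow_mul_rpow_natCast_nonneg {Q : ℝ} (hQ : 0 < Q) (N : ℕ) (a α : ℝ) :
    0 ≤ Q ^ a * (N : ℝ) ^ α := by positivity

theorem steinTomas_sq {Q N : ℝ} (hQ : 0 < Q) (hN : 0 ≤ N) (d : ℕ) :
    (Q ^ (-(d : ℝ) / 4) * N ^ (1 : ℝ)) ^ 2 = Q ^ (-(d : ℝ) / 2) * N ^ 2 := by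
  rw [rpow_mul_rpow_pow hQ hN, ← Real.rpow_natCast N]
  congr 2 <;> · push_cast; ring

end Indicator

/-- The restriction estimate dual to `L ^ 2 → L ^ (18 / 5)` in dimension three. -/
theorem exists_restrictionNorm_le_of_anisotropic :
    ∃ C : ℝ, 0 ≤ C ∧ ∀ (F : Type*) [Field F] [Fintype F], ringChar F ≠ 2 →
      (∀ x : Fin 2 → F, x ⬝ᵥ x = 0 → x = 0) → ∀ e : AddChar F ℂ, e ≠ 1 →
        ∀ f : (Fin 2 → F) × F → ℂ, restrictionNorm e f ≤ C * lrNorm (18 / 13) f := by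
  -- The bounds q^(-1/2)N and q^(1/16)N^(11/16) cross at N = q^(9/5) with common value N^(13/18), so
  -- the balance is exact.
  obtain ⟨C, hC, H⟩ := exists_restrictionNorm_le_of_indicator 2 (univ : Finset Bool)
    (ρ := 13 / 18) (by norm_num) (fun _ => 1) (fun i => if i then 1 / 2 else 11 / 16)
    (fun i => if i then 0 else -(2 : ℕ) / 4) (fun i => if i then 0 else 1 / 16)
    (fun i => by cases i <;> norm_num) (fun i => by cases i <;> norm_num)
    (fun i => by norm_num) (fun i => by cases i <;> norm_num)
  refine ⟨C, hC, fun F _ _ hF hiso e he f => ?_⟩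
  have h2 : (2 : F) ≠ 0 := Ring.two_ne_zero hF
  have hQ : (0 : ℝ) < Fintype.card F := by exact_mod_cast Fintype.card_pos
  have := H F e (fun G f hf hG => by
    rw [Fintype.sum_bool]
    simp only [if_true, Bool.false_eq_true, if_false]
    rw [min_natCast_rpow_half]
    refine le_two_mul_add_min (by positivity) (by positivity) (by positivity) ?_ ?_
    · rw [sq_rpow_half (by positivity), steinTomas_sq hQ (by positivity)]
      exact restrictionNorm_sq_le_steinTomas he G f hf hG h2
    · rw [sq_rpow_half (by positivity)]
      exact restrictionNorm_sq_le_of_anisotropic h2 he hiso G f hf hG) f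
  rwa [one_div_div] at this

/-- The restriction estimate dual to `L ^ 2 → L ^ (2n² / (n² - 2n + 2))` in dimension
`n = d + 1 ≥ 4`. -/
theorem exists_restrictionNorm_le (d : ℕ) (hd3 : 3 ≤ d) (n : ℝ) (hn : n = d + 1) :
    ∃ C : ℝ, 0 ≤ C ∧ ∀ (F : Type*) [Field F] [Fintype F], ringChar F ≠ 2 → IsNonhyperbolic F d →
      ∀ e : AddChar F ℂ, e ≠ 1 → ∀ f : (Fin d → F) × F → ℂ,
        restrictionNorm e f ≤ C * lrNorm (2 * n ^ 2 / (n ^ 2 + 2 * n - 2)) f := by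
  have hd3' : (3 : ℝ) ≤ d := by exact_mod_cast hd3
  have hn4 : 4 ≤ n := by linarith
  have hn0 : 0 < n := by linarith
  set ρ : ℝ := (n ^ 2 + 2 * n - 2) / (2 * n ^ 2) with hρ
  have hρ0 : 0 < ρ := div_pos (by nlinarith) (by positivity)
  have hρ1 : ρ < 1 := by rw [hρ, div_lt_one (by positivity)]; nlinarith
  have hρ2 : ρ < 3 / 4 := by rw [hρ, div_lt_div_iff₀ (by positivity) (by norm_num)]; nlinarith
  have hρ3 : 1 / 2 < ρ := by rw [hρ, div_lt_div_iff₀ (by norm_num) (by positivity)]; nlinarith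
  have hρn : 2 * n ^ 2 / (n ^ 2 + 2 * n - 2) = 1 / ρ := by rw [hρ, one_div_div]
  have hd : (d : ℝ) = n - 1 := by linarith
  -- The N^(3/4) energy term against the Plancherel bound q^(1/2)N^(1/2); the balance holds with
  -- room to spare.
  have hmid : (1 - (d : ℝ)) / 8 * (ρ - 1 / 2) + 1 / 2 * (3 / 4 - ρ) ≤ 0 := by
    have : (1 - (d : ℝ)) / 8 * (ρ - 1 / 2) + 1 / 2 * (3 / 4 - ρ) = (2 - n) / (8 * n ^ 2) := by
      rw [hρ, hd]; field_simp; ring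
    rw [this]
    exact div_nonpos_of_nonpos_of_nonneg (by linarith) (by positivity)
  rw [hρn]
  -- The exponent 5/8 of the other energy term lies below ρ for d ≤ 5 and above it for d ≥ 6. Its
  -- partner must lie on the other side of ρ: Stein–Tomas (exponent 1) in the first case, Plancherel
  -- (exponent 1/2) in the second.
  obtain h6 | h6 : d ≤ 5 ∨ 6 ≤ d := by omega
  · have hρ4 : 5 / 8 < ρ := by
      rw [hρ, div_lt_div_iff₀ (by norm_num) (by positivity)]
      have : (d : ℝ) ≤ 5 := by exact_mod_cast h6
      nlinarith
    obtain ⟨C, hC, H⟩ := exists_restrictionNorm_le_of_indicator d (univ : Finset (Fin 3)) hρ0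
      ![1, 3 / 4, 1] ![1 / 2, 1 / 2, 5 / 8] ![0, (1 - (d : ℝ)) / 8, -(d : ℝ) / 4]
      ![0, 1 / 2, (5 - (d : ℝ)) / 16]
      (fun i => by fin_cases i <;> norm_num)
      (fun i => by fin_cases i <;> assumption) (fun i => by fin_cases i <;> assumption)
      (fun i => by
        fin_cases i
        · simp
        · exact hmid
        · change -(d : ℝ) / 4 * (ρ - 5 / 8) + (5 - (d : ℝ)) / 16 * (1 - ρ) ≤ 0
          rw [hρ, hn]
          interval_cases d <;> norm_num)
    refine ⟨C, hC, fun F _ _ hF hH e he => H F e fun G f hf hG => ?_⟩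
    have hQ : (0 : ℝ) < Fintype.card F := by exact_mod_cast Fintype.card_pos
    rw [Fin.sum_univ_three]
    change _ ≤ 2 * (min (_ ^ (0 : ℝ) * _ ^ (1 : ℝ)) (_ ^ (0 : ℝ) * _ ^ (1 / 2 : ℝ)) +
      min (_ ^ ((1 - (d : ℝ)) / 8) * _ ^ (3 / 4 : ℝ)) (_ ^ (1 / 2 : ℝ) * _ ^ (1 / 2 : ℝ)) +
      min (_ ^ (-(d : ℝ) / 4) * _ ^ (1 : ℝ)) (_ ^ ((5 - (d : ℝ)) / 16) * _ ^ (5 / 8 : ℝ)))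
    rw [min_natCast_rpow_half]
    refine le_two_mul_add_min_add_min (Real.rpow_nonneg (Nat.cast_nonneg _) _)
      (rpow_mul_rpow_natCast_nonneg hQ _ _ _) (rpow_mul_rpow_natCast_nonneg hQ _ _ _)
      (rpow_mul_rpow_natCast_nonneg hQ _ _ _) (rpow_mul_rpow_natCast_nonneg hQ _ _ _) ?_ ?_ ?_
    · rw [mul_pow, sq_rpow_half hQ.le, sq_rpow_half (Nat.cast_nonneg _)]
      exact restrictionNorm_sq_le_card_mul he G f hf hG
    · rw [sq_rpow_half (Nat.cast_nonneg _), steinTomas_sq hQ (Nat.cast_nonneg _)]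
      exact restrictionNorm_sq_le_steinTomas he G f hf hG (Ring.two_ne_zero hF)
    · rw [sq_rpow_half (Nat.cast_nonneg _)]
      exact restrictionNorm_sq_le_of_isNonhyperbolic hF he hH G f hf hG
  · have hρ4 : ρ < 5 / 8 := by
      rw [hρ, div_lt_div_iff₀ (by positivity) (by norm_num)]
      have : (6 : ℝ) ≤ d := by exact_mod_cast h6
      nlinarith
    obtain ⟨C, hC, H⟩ := exists_restrictionNorm_le_of_indicator d (univ : Finset (Fin 3)) hρ0
      ![1, 3 / 4, 5 / 8] ![1 / 2, 1 / 2, 1 / 2] ![0, (1 - (d : ℝ)) / 8, (5 - (d : ℝ)) / 16]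
      ![0, 1 / 2, 1 / 2]
      (fun i => by fin_cases i <;> norm_num)
      (fun i => by fin_cases i <;> assumption) (fun i => by fin_cases i <;> assumption)
      (fun i => by
        fin_cases i
        · simp
        · exact hmid
        · change (5 - (d : ℝ)) / 16 * (ρ - 1 / 2) + 1 / 2 * (5 / 8 - ρ) ≤ 0
          have : (5 - (d : ℝ)) / 16 * (ρ - 1 / 2) + 1 / 2 * (5 / 8 - ρ) =
              (2 - n) / (16 * n ^ 2) := by
            rw [hρ, hd]; field_simp; ring
          rw [this]
          exact div_nonpos_of_nonpos_of_nonneg (by linarith) (by positivity))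
    refine ⟨C, hC, fun F _ _ hF hH e he => H F e fun G f hf hG => ?_⟩
    have hQ : (0 : ℝ) < Fintype.card F := by exact_mod_cast Fintype.card_pos
    rw [Fin.sum_univ_three]
    change _ ≤ 2 * (min (_ ^ (0 : ℝ) * _ ^ (1 : ℝ)) (_ ^ (0 : ℝ) * _ ^ (1 / 2 : ℝ)) +
      min (_ ^ ((1 - (d : ℝ)) / 8) * _ ^ (3 / 4 : ℝ)) (_ ^ (1 / 2 : ℝ) * _ ^ (1 / 2 : ℝ)) +
      min (_ ^ ((5 - (d : ℝ)) / 16) * _ ^ (5 / 8 : ℝ)) (_ ^ (1 / 2 : ℝ) * _ ^ (1 / 2 : ℝ)))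
    rw [min_natCast_rpow_half, min_comm (_ ^ ((5 - (d : ℝ)) / 16) * _)]
    have hL2 : restrictionNorm e f ^ 2 ≤
        ((Fintype.card F : ℝ) ^ (1 / 2 : ℝ) * (#G : ℝ) ^ (1 / 2 : ℝ)) ^ 2 := by
      rw [mul_pow, sq_rpow_half hQ.le, sq_rpow_half (Nat.cast_nonneg _)]
      exact restrictionNorm_sq_le_card_mul he G f hf hG
    refine le_two_mul_add_min_add_min (Real.rpow_nonneg (Nat.cast_nonneg _) _)
      (rpow_mul_rpow_natCast_nonneg hQ _ _ _) (rpow_mul_rpow_natCast_nonneg hQ _ _ _)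
      (rpow_mul_rpow_natCast_nonneg hQ _ _ _) (rpow_mul_rpow_natCast_nonneg hQ _ _ _) hL2 (hL2.trans (le_add_of_nonneg_left (sq_nonneg _))) ?_
    rw [sq_rpow_half (Nat.cast_nonneg _)]
    exact restrictionNorm_sq_le_of_isNonhyperbolic hF he hH G f hf hG

end RestrictionEstimate

/-! ### The estimates in every dimension n ≥ 3 -/

section Anisotropic

variable {F : Type*} [Field F]

theorem eq_zero_of_dotProduct_self_eq_zero (h : ¬ IsSquare (-1 : F)) (x : Fin 2 → F)
    (hx : x ⬝ᵥ x = 0) : x = 0 := by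
  rw [dotProduct, Fin.sum_univ_two] at hx
  have h1 : x 1 = 0 := by
    by_contra h1
    refine h ⟨x 0 / x 1, ?_⟩
    field_simp
    linear_combination -hx
  have h0 : x 0 = 0 := by simpa [h1] using hx
  funext i
  fin_cases i
  · exact h0
  · exact h1

end Anisotropic

/-- The restriction estimate dual to `L ^ 2 → L ^ (2n² / (n² - 2n + 2))` in dimension
`n = d + 1 ≥ 3`. -/
theorem exists_restrictionNorm_le_of_isNonhyperbolic (d : ℕ) (hd2 : 2 ≤ d) (n : ℝ)
    (hn : n = d + 1) :
    ∃ C : ℝ, 0 ≤ C ∧ ∀ (F : Type*) [Field F] [Fintype F], ringChar F ≠ 2 → IsNonhyperbolic F d →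
      ∀ e : AddChar F ℂ, e ≠ 1 → ∀ f : (Fin d → F) × F → ℂ,
        restrictionNorm e f ≤ C * lrNorm (2 * n ^ 2 / (n ^ 2 + 2 * n - 2)) f := by
  rcases hd2.eq_or_lt with rfl | hd3
  -- For d = 2 the general energy bound just fails: against Stein–Tomas, the N^(5/8) term misses the
  -- balance condition by 1/288.
  · obtain ⟨C, hC, H⟩ := exists_restrictionNorm_le_of_anisotropic
    refine ⟨C, hC, fun F _ _ hF hH e he f => ?_⟩
    have hsq : ¬ IsSquare (-1 : F) := by
      rcases hH with h | ⟨k, -, -, h⟩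
      · exact absurd h (by decide)
      · exact h
    have := H F hF (eq_zero_of_dotProduct_self_eq_zero hsq) e he f
    rw [hn]
    norm_num at this ⊢
    exact this
  · exact exists_restrictionNorm_le d hd3 n hn

/-- The restriction estimate dual to `L ^ (4n / (3n - 2)) → L ^ 4` in dimension `n = d + 1`. -/
theorem exists_lrNorm_restriction_le (d : ℕ) (hd2 : 2 ≤ d) (n : ℝ) (hn : n = d + 1) :
    ∃ C : ℝ, 0 ≤ C ∧ ∀ (F : Type*) [Field F] [Fintype F], ringChar F ≠ 2 → IsNonhyperbolic F d →
      ∀ e : AddChar F ℂ, e ≠ 1 → ∀ f : (Fin d → F) × F → ℂ,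
        lrNorm (4 * n / (n + 2)) (restriction e f) ≤
          C * (Fintype.card F : ℝ) ^ ((n - 1) * (n + 2) / (4 * n)) * lrNorm (4 / 3) f := by
  obtain ⟨C, hC, H⟩ := exists_lrNorm_extension_le d hd2 n hn
  have hn3 : 3 ≤ n := by
    have : (2 : ℝ) ≤ d := by exact_mod_cast hd2
    linarith
  refine ⟨C, hC, fun F _ _ hF hH e he f => ?_⟩
  have h4 : (4 : ℝ).HolderConjugate (4 / 3) := by rw [Real.holderConjugate_iff]; norm_num
  have hp : (4 * n / (3 * n - 2)).HolderConjugate (4 * n / (n + 2)) := by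
    rw [Real.holderConjugate_iff, lt_div_iff₀ (by linarith), inv_div, inv_div]
    refine ⟨by linarith, ?_⟩
    field_simp
    ring
  -- The transpose is taken without conjugation, so the extension is evaluated at -p.
  refine lrNorm_le_of_transpose h4 hp (by positivity) f (restriction e f)
    (fun g p => extension e g (-p)) (fun g => ?_) (fun g => ?_)
  · simp only [restriction, extension, mul_sum]
    rw [sum_comm]
    refine sum_congr rfl fun p _ => sum_congr rfl fun γ _ => ?_
    rw [mul_left_comm, Prod.fst_neg, Prod.snd_neg, neg_dotProduct, neg_mul, ← neg_add]
  · have : lrNorm 4 (fun p => extension e g (-p)) = lrNorm 4 (extension e g) := by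
      rw [lrNorm, lrNorm]
      congr 1
      exact Fintype.sum_equiv (Equiv.neg _) _ _ fun p => rfl
    rw [this]
    exact H F hF hH e he g

/-! ### Translation to functions on F^n and the final theorem -/

namespace FiniteFieldRestriction

variable {F : Type*} [Field F] {d : ℕ}

theorem paraboloidPoint_castSucc (γ : Fin d → F) (i : Fin d) :
    paraboloidPoint (n := d + 1) γ i.castSucc = γ i := by
  simp [paraboloidPoint]

theorem paraboloidPoint_last (γ : Fin d → F) :
    paraboloidPoint (n := d + 1) γ (Fin.last d) = γ ⬝ᵥ γ := by
  simp [paraboloidPoint]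

theorem paraboloidPoint_injective :
    Function.Injective (paraboloidPoint (F := F) (n := d + 1)) := fun γ γ' h => by
  funext i
  have := congrFun h (Fin.castSucc i)
  rwa [paraboloidPoint_castSucc, paraboloidPoint_castSucc] at this

theorem snoc_dotProduct_paraboloidPoint (y : Fin d → F) (t : F) (γ : Fin d → F) :
    (Fin.snoc y t : Fin (d + 1) → F) ⬝ᵥ paraboloidPoint (n := d + 1) γ =
      y ⬝ᵥ γ + t * (γ ⬝ᵥ γ) := by
  rw [dotProduct, Fin.sum_univ_castSucc]
  simp only [paraboloidPoint_castSucc, paraboloidPoint_last, Fin.snoc_castSucc, Fin.snoc_last]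
  rfl

variable [Fintype F]

theorem sum_paraboloid {M : Type*} [AddCommMonoid M] (h : (Fin (d + 1) → F) → M) :
    ∑ ξ ∈ paraboloid F (d + 1), h ξ = ∑ γ : Fin d → F, h (paraboloidPoint (n := d + 1) γ) := by
  classical
  exact sum_image fun _ _ _ _ h => paraboloidPoint_injective h

theorem card_paraboloid : #(paraboloid F (d + 1)) = Fintype.card F ^ d := by
  rw [card_eq_sum_ones, sum_paraboloid]
  simp

omit [Field F] in
theorem sum_snoc {M : Type*} [AddCommMonoid M] (h : (Fin (d + 1) → F) → M) :
    ∑ x, h x = ∑ p : (Fin d → F) × F, h (Fin.snoc p.1 p.2) := by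
  refine (Fintype.sum_equiv ((Equiv.prodComm _ _).trans (Fin.snocEquiv fun _ => F)) _ _
    fun p => rfl).symm

/-- A function on `F ^ (d + 1)` as a function on `F ^ d × F`. -/
def splitLast (f : (Fin (d + 1) → F) → ℂ) (p : (Fin d → F) × F) : ℂ := f (Fin.snoc p.1 p.2)

theorem fourier_paraboloidPoint (e : AddChar F ℂ) (f : (Fin (d + 1) → F) → ℂ) (γ : Fin d → F) :
    fourier e f (paraboloidPoint (n := d + 1) γ) = restriction e (splitLast f) γ := by
  rw [fourier, sum_snoc]
  simp only [snoc_dotProduct_paraboloidPoint]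
  rfl

omit [Field F] in
theorem normSpace_eq (r : ℝ) (f : (Fin (d + 1) → F) → ℂ) :
    normSpace r f = lrNorm r (splitLast f) := by
  rw [normSpace, sum_snoc]
  rfl

theorem normSurface_fourier {r : ℝ} (e : AddChar F ℂ) (f : (Fin (d + 1) → F) → ℂ) :
    normSurface r (fourier e f) =
      (Fintype.card F : ℝ) ^ (-((d : ℝ) / r)) * lrNorm r (restriction e (splitLast f)) := by
  have hQ : (0 : ℝ) < Fintype.card F := by exact_mod_cast Fintype.card_pos
  rw [normSurface, card_paraboloid, sum_paraboloid, Real.mul_rpow (by positivity)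
    (sum_nonneg fun _ _ => by positivity), lrNorm]
  simp only [fourier_paraboloidPoint]
  congr 1
  rw [one_div, Nat.cast_pow, ← Real.rpow_natCast, ← Real.rpow_neg hQ.le, ← Real.rpow_mul hQ.le]
  congr 1
  ring

theorem restrictionConst_le {n : ℕ} {e : AddChar F ℂ} {p q : ℝ} {C : ℝ≥0}
    (h : ∀ f : (Fin n → F) → ℂ,
      normSurface p.conjExponent (fourier e f) ≤ C * normSpace q.conjExponent f) :
    restrictionConst n e p q ≤ C :=
  iInf₂_le C h

/-- As d is even and 4 does not divide m d, both d/2 and m are odd. Hence |F| = q^m ≡ 3 mod 4, and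
-1 is not a square. -/
theorem isNonhyperbolic_of_card {q m : ℕ} (hq : q % 4 = 3) (hF : Fintype.card F = q ^ m)
    (hd : Even d) (hmd : ¬ 4 ∣ m * d) : IsNonhyperbolic F d := by
  obtain ⟨k, rfl⟩ := hd.exists_two_nsmul
  rw [smul_eq_mul] at *
  have hk : Odd k := by
    by_contra h
    obtain ⟨j, rfl⟩ := (Nat.not_odd_iff_even.mp h).exists_two_nsmul
    exact hmd ⟨m * j, by rw [smul_eq_mul]; ring⟩
  have hm : Odd m := by
    by_contra h
    obtain ⟨j, rfl⟩ := (Nat.not_odd_iff_even.mp h).exists_two_nsmul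
    exact hmd ⟨j * k, by rw [smul_eq_mul]; ring⟩
  refine Or.inr ⟨k, rfl, hk, fun h => FiniteField.isSquare_neg_one_iff.mp h ?_⟩
  obtain ⟨j, rfl⟩ := hm
  rw [hF, Nat.pow_mod, hq, pow_succ, pow_mul, Nat.mul_mod, Nat.pow_mod]
  simp

end FiniteFieldRestriction

open FiniteFieldRestriction in
theorem exists_restrictionConst_le (d : ℕ) (hd : 2 ≤ d) :
    ∃ C : ℝ≥0, ∀ (F : Type*) [Field F] [Fintype F], ringChar F ≠ 2 → IsNonhyperbolic F d →
      ∀ e : AddChar F ℂ, e ≠ 1 →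
        restrictionConst (d + 1) e
            (4 * ((d + 1 : ℕ) : ℝ) / (3 * ((d + 1 : ℕ) : ℝ) - 2)) 4 ≤ C ∧
        restrictionConst (d + 1) e 2 (2 * ((d + 1 : ℕ) : ℝ) ^ 2 /
          (((d + 1 : ℕ) : ℝ) ^ 2 - 2 * ((d + 1 : ℕ) : ℝ) + 2)) ≤ C := by
  set n : ℝ := ((d + 1 : ℕ) : ℝ) with hn
  have hnd : n = d + 1 := by rw [hn]; push_cast; rfl
  have hn3 : 3 ≤ n := by
    have : (2 : ℝ) ≤ d := by exact_mod_cast hd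
    linarith
  obtain ⟨C₁, h₁, H₁⟩ := exists_lrNorm_restriction_le d hd n hnd
  obtain ⟨C₂, h₂, H₂⟩ := exists_restrictionNorm_le_of_isNonhyperbolic d hd n hnd
  have e1 : (4 * n / (3 * n - 2)).conjExponent = 4 * n / (n + 2) := by
    rw [Real.conjExponent, div_sub_one (by linarith), div_div_div_cancel_right₀ (by linarith)]
    congr 1
    ring
  have e2 : (4 : ℝ).conjExponent = 4 / 3 := by norm_num [Real.conjExponent]
  have e3 : (2 : ℝ).conjExponent = 2 := by norm_num [Real.conjExponent]
  have e4 : (2 * n ^ 2 / (n ^ 2 - 2 * n + 2)).conjExponent =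
      2 * n ^ 2 / (n ^ 2 + 2 * n - 2) := by
    have h0 : n ^ 2 - 2 * n + 2 ≠ 0 := by nlinarith
    rw [Real.conjExponent, div_sub_one h0, div_div_div_cancel_right₀ h0]
    congr 1
    ring
  refine ⟨⟨max C₁ C₂, le_max_of_le_left h₁⟩, fun F _ _ hF hH e he => ⟨?_, ?_⟩⟩
  · refine restrictionConst_le fun f => ?_
    have hQ : (0 : ℝ) < Fintype.card F := by exact_mod_cast Fintype.card_pos
    rw [e1, e2, normSurface_fourier, normSpace_eq]
    have h := H₁ F hF hH e he (splitLast f)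
    have h5 : (d : ℝ) / (4 * n / (n + 2)) = (n - 1) * (n + 2) / (4 * n) := by
      rw [hnd, add_sub_cancel_right, div_div_eq_mul_div]
    rw [h5, Real.rpow_neg hQ.le, inv_mul_le_iff₀ (by positivity)]
    refine h.trans ?_
    rw [mul_comm C₁, mul_assoc]
    refine mul_le_mul_of_nonneg_left ?_ (by positivity)
    exact mul_le_mul_of_nonneg_right (le_max_left _ _) (lrNorm_nonneg _ _)
  · refine restrictionConst_le fun f => ?_
    rw [e3, e4, normSurface_fourier, normSpace_eq, ← neg_div]
    refine (H₂ F hF hH e he (splitLast f)).trans ?_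
    exact mul_le_mul_of_nonneg_right (le_max_right _ _) (lrNorm_nonneg _ _)

theorem theorem2 (n : ℕ) :
    ∃ C : ℝ≥0, ∀ (F : Type*) [Field F] [Fintype F], ringChar F ≠ 2 →
      ((4 ≤ n ∧ Even n) ∨
        (Odd n ∧ ∃ q m : ℕ, q.Prime ∧ q % 4 = 3 ∧ Fintype.card F = q ^ m ∧ ¬ 4 ∣ m * (n - 1))) →
      ∀ e : AddChar F ℂ, e ≠ 1 →
        FiniteFieldRestriction.restrictionConst n e
            (4 * (n : ℝ) / (3 * (n : ℝ) - 2)) 4 ≤ C ∧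
        FiniteFieldRestriction.restrictionConst n e
            2 (2 * (n : ℝ) ^ 2 / ((n : ℝ) ^ 2 - 2 * (n : ℝ) + 2)) ≤ C := by
  by_cases hn : 3 ≤ n
  · obtain ⟨d, rfl⟩ : ∃ d, n = d + 1 := ⟨n - 1, by omega⟩
    obtain ⟨C, H⟩ := exists_restrictionConst_le d (by omega)
    refine ⟨C, fun F _ _ hF h e he => H F hF ?_ e he⟩
    rcases h with ⟨-, h⟩ | ⟨h, q, m, -, hq, hc, hm⟩
    · exact Or.inl (by rw [← Nat.not_even_iff_odd]; exact Nat.even_add_one.mp h)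
    · refine FiniteFieldRestriction.isNonhyperbolic_of_card hq hc ?_ hm
      rw [← Nat.not_odd_iff_even]
      exact Nat.odd_add_one.mp h
  -- For n ≤ 2 the hypotheses cannot hold: oddness leaves n = 1, and then m(n - 1) = 0 is a multiple
  -- of 4.
  · refine ⟨0, fun F _ _ _ h => ?_⟩
    exfalso
    rcases h with ⟨h, -⟩ | ⟨h, q, m, -, -, -, hm⟩
    · omega
    · obtain rfl : n = 1 := by
        obtain ⟨k, rfl⟩ := h
        omega
      simp at hm
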